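/- Let $\Gamma$ be a two-dimensional crystallographic group generated by translations and rotations, i.e. a group with a given faithful, discrete, cocompact representation $\Phi_0:\Gamma\to\operatorname{Euc}(2)$ in which every element acts with linear part a rotation $\operatorname{rot}(\gamma)\in SO(2)$. An element is a translation if $\operatorname{rot}(\gamma)=\mathrm{id}$, and a rotation otherwise; $\Lambda(\Gamma')$ is the subgroup of translations of $\Gamma'\le\Gamma$. Let $\operatorname{rep}(\Gamma')$ be the dimension of the space of representations $\Gamma'\to\operatorname{Euc}(2)$ that extend to a discrete faithful representation of $\Gamma$, and let $T(\Gamma')=0$ if $\Gamma'$ contains a rotation, $T(\Gamma')=2$ otherwise. A $\Gamma$-crystallographic direction network $(\tilde G,\varphi,\tilde{\mathbf d})$ is a multigraph $\tilde G$ with a $\Gamma$-action $\varphi$, free on vertices and edges and with finite quotient, together with a nonzero vector $\tilde{\mathbf d}_e\in\mathbb R^2$ for every edge $e$ such that $\tilde{\mathbf d}_{\gamma e}=\operatorname{rot}(\gamma)\tilde{\mathbf d}_e$. Choosing representatives $\tilde\imath$ of the vertex orbits and an orientation of the edge orbits, its colored quotient graph is the finite directed multigraph $G$ of orbits in which the edge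 orbit with a representative from $\tilde\imath$ to $\gamma\cdot\tilde\jmath$ becomes an edge $ij$ with color $\gamma$. For a vertex $b$ of a subgraph $G'$ of $G$, let $\rho(\pi_1(G',b))\le\Gamma$ be the group of products of colors (inverted on edges traversed backwards) along closed walks of $G'$ at $b$. For a subgraph $G'$ with $n'$ vertices, connected components $G'_1,\dots,G'_c$ and base vertices $b_i\in G'_i$, put $$f(G')=2n'+\operatorname{rep}\big(\langle \Lambda(\rho(\pi_1(G'_i,b_i))): 1\le i\le c\rangle\big)-\sum_{i=1}^c T\big(\rho(\pi_1(G'_i,b_i))\big).$$ $G$, with $n$ vertices and $m$ edges, is $\Gamma$-colored-Laman if $m=2n+\operatorname{rep}(\Lambda(\Gamma))-T(\Gamma)-1$ and every subgraph $G'$ with $m'\ge1$ edges satisfies $m'\le f(G')-1$. A realization of $(\tilde G,\varphi,\tilde{\mathbf d})$ consists of points $\mathbf p_i\in\mathbb R^2$ $(i\in V(\tilde G))$ and a representation $\Phi:\Gamma\to\operatorname{Euc}(2)$, in which $\Phi(\gamma)$ has linear part $\operatorname{rot}(\gamma)$ for all $\gamma$, such that $\mathbf p_{\gamma i}=\Phi(\gamma)\mathbf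 p_i$ for all $\gamma$ and $i$, and $\langle\mathbf p_j-\mathbf p_i,\tilde{\mathbf d}_e^\perp\rangle=0$ for every edge $e$ with ends $i,j$. It is faithful if $\mathbf p_i\ne\mathbf p_j$ for every edge with ends $i,j$ and $\Phi$ is nontrivial on the translations of $\Gamma$. Theorem. For every $(\tilde G,\varphi)$ there is a proper algebraic subset of the space of direction assignments $\tilde{\mathbf d}$ (parametrized by the vectors on one representative of every edge orbit) such that for every $\tilde{\mathbf d}$ outside this subset: 1. $(\tilde G,\varphi,\tilde{\mathbf d})$ has a faithful realization that is unique up to translation and (nonzero real) scaling if and only if its colored quotient graph is $\Gamma$-colored-Laman. 2. If the colored quotient graph has at least $2n+\operatorname{rep}(\Lambda(\Gamma))-T(\Gamma)-1$ edges, then $(\tilde G,\varphi,\tilde{\mathbf d})$ has a faithful realization if and only if its colored quotient graph is $\Gamma$-colored-Laman. -/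

import Mathlib

/-! The Euclidean plane is `ℂ` (a real inner product space), and `Euc(2)` is the group
`ℂ ≃ᵃⁱ[ℝ] ℂ` of its isometries. -/

namespace Crystal

/-- The group of isometries of the Euclidean plane. -/
abbrev Euc : Type := ℂ ≃ᵃⁱ[ℝ] ℂ

/-- The derivative `Euc(2) → O(2)` of an isometry. -/
noncomputable def linPart : Euc →* (ℂ ≃ₗᵢ[ℝ] ℂ) where
  toFun g := g.linearIsometryEquiv
  map_one' := rfl
  map_mul' _ _ := rfl

section Group

variable {Γ : Type*} [Group Γ]

/-- `Φ` is discrete and faithful: it is injective, and only finitely many elements of `Γ` move the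
origin into a given disc. -/
def IsDiscreteFaithful (Φ : Γ →* Euc) : Prop :=
  Function.Injective Φ ∧ ∀ R : ℝ, {γ : Γ | ‖Φ γ 0‖ ≤ R}.Finite

/-- `Φ₀` presents `Γ` as a two-dimensional crystallographic group that consists of rotations and
translations: `Φ₀` is discrete, faithful and cocompact, and every isometry `Φ₀ γ` has a rotation as
its linear part (no reflections and no glides). -/
def IsCrystallographic (Φ₀ : Γ →* Euc) : Prop :=
  IsDiscreteFaithful Φ₀ ∧
  (∃ R : ℝ, ∀ x : ℂ, ∃ γ : Γ, dist (Φ₀ γ 0) x ≤ R) ∧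
  ∀ γ : Γ, ∃ a : Circle, linPart (Φ₀ γ) = rotation a

/-- The subgroup `Λ(Γ)` of translations of `Γ`. -/
noncomputable def transl (Φ₀ : Γ →* Euc) : Subgroup Γ := (linPart.comp Φ₀).ker

/-- `Φ` has the same rotational parts as the given `Φ₀`. Such representations send translations of
`Γ` to arbitrary (possibly zero) translations, and rotations of `Γ` to rotations through the
prescribed angle, about arbitrary centers. -/
def SameRotations (Φ₀ Φ : Γ →* Euc) : Prop :=
  ∀ γ : Γ, linPart (Φ γ) = linPart (Φ₀ γ)

/-- `rep_Γ(H)`: the dimension of the space of representations of the subgroup `H` that extend to a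
discrete faithful representation of `Γ`. With its rotational parts fixed, a representation `Φ` is
given by its vectors `Φ γ 0`; the discrete faithful ones are an open dense subset of a real
vector space in these coordinates, so the dimension of the space of restrictions to `H` is
that of its linear span. (Discrete faithful representations with the opposite rotational parts are
the mirror images of these, and they do not change the dimension.) -/
noncomputable def rep (Φ₀ : Γ →* Euc) (H : Subgroup Γ) : ℕ :=
  Module.finrank ℝ (Submodule.span ℝ
    {τ : H → ℂ | ∃ Φ : Γ →* Euc, IsDiscreteFaithful Φ ∧ SameRotations Φ₀ Φ ∧
      ∀ h : H, τ h = Φ h 0})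

open Classical in
/-- `T(H)` is `2` if `H` has no rotations, and `0` if it has one. -/
noncomputable def T (Φ₀ : Γ →* Euc) (H : Subgroup Γ) : ℕ :=
  if H ≤ transl Φ₀ then 2 else 0

end Group

/-- A directed multigraph (loops allowed) with vertex set `V`, edge set `E`, and edges colored by
elements of `Γ`. -/
structure ColoredGraph (Γ V E : Type*) where
  tail : E → V
  head : E → V
  color : E → Γ

namespace ColoredGraph

variable {Γ V E : Type*} [Group Γ] (G : ColoredGraph Γ V E)

/-- `G.Walk F u v g`: some walk from `u` to `v` along edges in `F` has `ρ`-value `g`, the product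
of the colors along the walk, inverted at the edges that are traversed backwards. -/
inductive Walk (F : Finset E) (u : V) : V → Γ → Prop
  | nil : Walk F u u 1
  | forward {e : E} {g : Γ} (he : e ∈ F) (h : Walk F u (G.tail e) g) :
      Walk F u (G.head e) (g * G.color e)
  | backward {e : E} {g : Γ} (he : e ∈ F) (h : Walk F u (G.head e) g) :
      Walk F u (G.tail e) (g * (G.color e)⁻¹)

variable {G}

theorem Walk.trans {F : Finset E} {u v w : V} {g h : Γ} (p : G.Walk F u v g)
    (q : G.Walk F v w h) : G.Walk F u w (g * h) := by
  induction q with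
  | nil => simpa using p
  | forward he _ ih => rw [← mul_assoc]; exact ih.forward he
  | backward he _ ih => rw [← mul_assoc]; exact ih.backward he

theorem Walk.symm {F : Finset E} {u v : V} {g : Γ} (p : G.Walk F u v g) :
    G.Walk F v u g⁻¹ := by
  induction p with
  | nil => simpa using Walk.nil
  | forward he _ ih =>
    rw [mul_inv_rev]
    exact Walk.trans (by simpa using (Walk.nil (G := G) (Γ := Γ)).backward he) ih
  | backward he _ ih =>
    rw [mul_inv_rev, inv_inv]
    exact Walk.trans (by simpa using (Walk.nil (G := G) (Γ := Γ)).forward he) ih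

variable (G)

/-- `ρ(π₁(·, b))` for the graph with edge set `F`: the group of the `ρ`-values of its closed
walks at `b`. -/
def gainGroup (F : Finset E) (b : V) : Subgroup Γ where
  carrier := {g | G.Walk F b b g}
  one_mem' := Walk.nil
  mul_mem' p q := Walk.trans p q
  inv_mem' p := Walk.symm p

/-- Two vertices are in the same connected component of the graph with edge set `F`. -/
def compSetoid (F : Finset E) : Setoid V where
  r u v := ∃ g : Γ, G.Walk F u v g
  iseqv :=
    { refl := fun _ => ⟨1, Walk.nil⟩
      symm := fun ⟨_, p⟩ => ⟨_, p.symm⟩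
      trans := fun ⟨_, p⟩ ⟨_, q⟩ => ⟨_, p.trans q⟩ }

open Classical in
/-- The connected components of the subgraph with vertex set `W` and edge set `F` (when the ends of
the edges in `F` lie in `W`). -/
noncomputable def comps (W : Finset V) (F : Finset E) : Finset (Quotient (G.compSetoid F)) :=
  W.image (fun v => Quotient.mk (G.compSetoid F) v)

/-- `Λ(G', B)` for the subgraph `G' = (W, F)`: the group generated by the translations in the groups
`ρ(π₁(G'ᵢ, bᵢ))`, with one base vertex `bᵢ = c.out` chosen in every component `c = G'ᵢ`. -/
noncomputable def translGroup (Φ₀ : Γ →* Euc) (W : Finset V) (F : Finset E) : Subgroup Γ :=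
  ⨆ c ∈ G.comps W F, G.gainGroup F c.out ⊓ transl Φ₀

/-- The sparsity function `f(G') = 2n' + rep(G') - ∑ᵢ T(G'ᵢ)` of the subgraph `G' = (W, F)`. -/
noncomputable def f (Φ₀ : Γ →* Euc) (W : Finset V) (F : Finset E) : ℤ :=
  2 * (W.card : ℤ) + rep Φ₀ (G.translGroup Φ₀ W F)
    - ∑ c ∈ G.comps W F, (T Φ₀ (G.gainGroup F c.out) : ℤ)

end ColoredGraph

/-- The number `2n + rep(Λ(Γ)) - T(Γ) - 1`, the number of edges of a `Γ`-colored-Laman graph on `n`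
vertices. -/
noncomputable def lamanCount {Γ : Type*} [Group Γ] (Φ₀ : Γ →* Euc) (n : ℕ) : ℤ :=
  2 * (n : ℤ) + rep Φ₀ (transl Φ₀) - T Φ₀ (⊤ : Subgroup Γ) - 1

/-- `Γ`-colored-Laman graphs. The sparsity condition is on the subgraphs `(W, F)` with at least
one edge. -/
def ColoredGraph.IsColoredLaman {Γ V E : Type*} [Group Γ] [Fintype V] [Fintype E]
    (G : ColoredGraph Γ V E) (Φ₀ : Γ →* Euc) : Prop :=
  (Fintype.card E : ℤ) = lamanCount Φ₀ (Fintype.card V) ∧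
  ∀ (W : Finset V) (F : Finset E), F.Nonempty → (∀ e ∈ F, G.tail e ∈ W ∧ G.head e ∈ W) →
    (F.card : ℤ) ≤ G.f Φ₀ W F - 1

/-- A multigraph `G̃` with vertex set `V` and edge set `E`, with an action of `Γ` that is free on the
vertices and on the edges and has finite quotient. -/
structure SymGraph (Γ V E : Type*) [Group Γ] [MulAction Γ V] [MulAction Γ E] where
  ends : E → Sym2 V
  ends_smul : ∀ (γ : Γ) (e : E), ends (γ • e) = (ends e).map (fun v => γ • v)
  free_vertex : ∀ (γ : Γ) (v : V), γ • v = v → γ = 1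
  free_edge : ∀ (γ : Γ) (e : E), γ • e = e → γ = 1
  finite_vertex : Finite (MulAction.orbitRel.Quotient Γ V)
  finite_edge : Finite (MulAction.orbitRel.Quotient Γ E)

/-- A colored quotient graph of `G̃`: one representative `vrep i` of every vertex orbit, an
orientation of every edge orbit, and the representative `erep a` of that orbit whose tail is a vertex
representative; its head is then `γ • vrep j` for a unique `γ`, which is the color. -/
structure SymGraph.ColoredQuotient {Γ V E : Type*} [Group Γ] [MulAction Γ V] [MulAction Γ E]
    (X : SymGraph Γ V E) (V' E' : Type*) where
  graph : ColoredGraph Γ V' E'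
  vrep : V' → V
  vrep_unique : ∀ v : V, ∃! i : V', ∃ γ : Γ, γ • vrep i = v
  erep : E' → E
  erep_unique : ∀ e : E, ∃! a : E', ∃ γ : Γ, γ • erep a = e
  ends_erep : ∀ a : E', X.ends (erep a) =
    s(vrep (graph.tail a), graph.color a • vrep (graph.head a))

theorem exists_smul_out {Γ α : Type*} [Group Γ] [MulAction Γ α] (x : α) :
    ∃ γ : Γ, γ • (Quotient.mk (MulAction.orbitRel Γ α) x).out = x :=
  (MulAction.orbitRel Γ α).symm (Quotient.mk_out (s := MulAction.orbitRel Γ α) x)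

theorem mk_smul {Γ α : Type*} [Group Γ] [MulAction Γ α] (γ : Γ) (x : α) :
    Quotient.mk (MulAction.orbitRel Γ α) (γ • x) = Quotient.mk (MulAction.orbitRel Γ α) x :=
  Quotient.sound (s := MulAction.orbitRel Γ α) ⟨γ, rfl⟩

/-- Every such `G̃` has a colored quotient graph, on its finite sets of vertex and edge orbits. -/
theorem SymGraph.nonempty_coloredQuotient {Γ V E : Type*} [Group Γ] [MulAction Γ V]
    [MulAction Γ E] (X : SymGraph Γ V E) :
    Nonempty (X.ColoredQuotient (MulAction.orbitRel.Quotient Γ V)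
      (MulAction.orbitRel.Quotient Γ E)) := by
  have key : ∀ a : MulAction.orbitRel.Quotient Γ E, ∃ (e : E)
      (i j : MulAction.orbitRel.Quotient Γ V) (g : Γ),
      Quotient.mk (MulAction.orbitRel Γ E) e = a ∧ X.ends e = s(i.out, g • j.out) := by
    intro a
    obtain ⟨u, v, huv⟩ : ∃ u v, X.ends a.out = s(u, v) := by
      induction h : X.ends a.out with | _ u v => exact ⟨u, v, rfl⟩
    obtain ⟨g, hg⟩ := exists_smul_out (Γ := Γ) u
    obtain ⟨h, hh⟩ := exists_smul_out (Γ := Γ) v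
    refine ⟨g⁻¹ • a.out, Quotient.mk _ u, Quotient.mk _ v, g⁻¹ * h, ?_, ?_⟩
    · rw [mk_smul, Quotient.out_eq]
    · rw [X.ends_smul, huv, Sym2.map_mk, mul_smul, hh, ← eq_inv_smul_iff.2 hg]
  choose e i j g he hends using key
  refine ⟨⟨⟨i, j, g⟩, Quotient.out, ?_, e, ?_, hends⟩⟩
  · intro v
    refine ⟨_, exists_smul_out v, ?_⟩
    rintro q ⟨γ, rfl⟩
    rw [mk_smul, Quotient.out_eq]
  · intro b
    refine ⟨Quotient.mk _ b, (MulAction.orbitRel Γ E).symm (Quotient.exact (he _)), ?_⟩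
    rintro q ⟨γ, rfl⟩
    rw [mk_smul, he]

section Network

variable {Γ V E : Type*} [Group Γ] [MulAction Γ V] [MulAction Γ E]

/-- An assignment of a direction to every edge, such that `γ` acts on directions through its
rotational part. -/
structure IsDirection (Φ₀ : Γ →* Euc) (d : E → ℂ) : Prop where
  ne_zero : ∀ e : E, d e ≠ 0
  equivariant : ∀ (γ : Γ) (e : E), d (γ • e) = linPart (Φ₀ γ) (d e)

/-- The points `p` and the representation `Φ` are a realization of the direction network
`(G̃, φ, d)`; `Complex.I * d e` is the direction `d e` turned through a right angle. -/
structure IsRealization (Φ₀ : Γ →* Euc) (X : SymGraph Γ V E) (d : E → ℂ)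
    (p : V → ℂ) (Φ : Γ →* Euc) : Prop where
  rotations : SameRotations Φ₀ Φ
  direction : ∀ (e : E) (i j : V), X.ends e = s(i, j) →
    inner ℝ (p j - p i) (Complex.I * d e) = 0
  equivariant : ∀ (γ : Γ) (i : V), p (γ • i) = Φ γ (p i)

/-- A faithful realization: no edge has coincident endpoints, and `Φ` is not trivial on the
translations of `Γ`. -/
structure IsFaithful (Φ₀ : Γ →* Euc) (X : SymGraph Γ V E) (d : E → ℂ)
    (p : V → ℂ) (Φ : Γ →* Euc) : Prop extends IsRealization Φ₀ X d p Φ where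
  noncollapsed : ∀ (e : E) (i j : V), X.ends e = s(i, j) → p i ≠ p j
  nontrivial : ∃ γ ∈ transl Φ₀, Φ γ ≠ 1

/-- `(p', Φ')` arises from `(p, Φ)` by the map `x ↦ s x + c` of the plane, which scales by a real
number `s ≠ 0` and then translates. -/
def TranslateScale (p : V → ℂ) (Φ : Γ →* Euc) (p' : V → ℂ) (Φ' : Γ →* Euc) : Prop :=
  ∃ (s : ℝ) (c : ℂ), s ≠ 0 ∧ (∀ i : V, p' i = s * p i + c) ∧
    ∀ (γ : Γ) (x : ℂ), Φ' γ (s * x + c) = s * Φ γ x + c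

/-- The direction network has a faithful realization. -/
def HasFaithful (Φ₀ : Γ →* Euc) (X : SymGraph Γ V E) (d : E → ℂ) : Prop :=
  ∃ (p : V → ℂ) (Φ : Γ →* Euc), IsFaithful Φ₀ X d p Φ

/-- The direction network has a faithful realization, and only one up to translation and scaling. -/
def HasUniqueFaithful (Φ₀ : Γ →* Euc) (X : SymGraph Γ V E) (d : E → ℂ) : Prop :=
  ∃ (p : V → ℂ) (Φ : Γ →* Euc), IsFaithful Φ₀ X d p Φ ∧
    ∀ (p' : V → ℂ) (Φ' : Γ →* Euc), IsFaithful Φ₀ X d p' Φ' → TranslateScale p Φ p' Φ'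

/-- The real coordinates of an equivariant direction assignment: those of the directions of the
chosen representatives of the edge orbits. -/
def coords {X : SymGraph Γ V E} {V' E' : Type*} (Q : X.ColoredQuotient V' E') (d : E → ℂ) :
    E' × Fin 2 → ℝ :=
  fun a => ![(d (Q.erep a.1)).re, (d (Q.erep a.1)).im] a.2

end Network

end Crystal

/-! Since the rotational parts are prescribed, a realization is a point `w = (p, τ)` of a real vector
space (`Configuration`): the positions `p` of the vertex representatives, and the cocycle
`τ γ = Φ γ 0`. For every edge `a` of the colored graph the vector between the ends of its
representative is a linear function `edgeVector a w`, and the direction equation of `a` is a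
combination of its two coordinates, with the coordinates of the direction as coefficients. The
network therefore asks for the common zeros of generic members of the two-generated spaces `A a` of
functionals that are spanned by these coordinates.

By Rado's theorem (`RadoCondition.exists_linearIndependent`), generic members of the `A a` are
independent if and only if `|F| ≤ dim (∑ a ∈ F, A a)` for every set `F` of edges. The annihilator of
`∑ a ∈ F, A a` is the space of configurations in which all edges in `F` are collapsed. On a
component of `F`, such a configuration is determined by its cocycle and a common fixed point of the
group `ρ(π₁)` of the component. This fixed point exists if and only if the translations in that group
vanish (`exists_fixed_iff`), and it is unique if and only if the group has a rotation; summing up,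
`dim (∑ a ∈ F, A a) = f(F)` (`f_univ_add_finrank_collapsed`). Here `rep` enters because discrete
faithful representations span the space of all cocycles
(`IsCrystallographic.rep_add_finrank_vanishing`): on the lattice of translations every cocycle is a
linear image of the given one, so that small perturbations of a discrete faithful representation are
again discrete and faithful.

If `|F| ≤ f(F) - 1` for all nonempty `F`, then Rado's condition still holds after the restriction to
any hyperplane, so that for generic directions the solutions are contained in no given hyperplane,
and some solution is faithful (`exists_mvPolynomial_solutions`). If the condition fails, then the
equations of a minimal violating set `F` generically span `∑ a ∈ F, A a`, and all solutions collapse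
the edges in `F` (`exists_mvPolynomial_solutions_le`). The number of edges in the Laman condition is
the dimension of the configuration space minus three, and the solutions then are the multiples of one
faithful solution up to the two-dimensional space of translations of the plane. With fewer edges the
solution space is larger, and a faithful solution is not unique. -/

/-! ### Rado's theorem for subspaces, and generic functionals -/

namespace Crystal

open Module

section Rado

variable {K V ι : Type*} [Field K] [AddCommGroup V] [Module K V]

/-- Rado's condition on a family of subspaces: any `k` of them span a space of dimension at
least `k`. -/
def RadoCondition (A : ι → Submodule K V) : Prop :=
  ∀ F : Finset ι, F.card ≤ finrank K (F.sup A : Submodule K V)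

theorem sup_update_of_notMem [DecidableEq ι] (A : ι → Submodule K V) {i : ι} (B : Submodule K V)
    {F : Finset ι} (hi : i ∉ F) : F.sup (Function.update A i B) = F.sup A :=
  Finset.sup_congr rfl fun j hj => by
    rw [Function.update_of_ne]
    rintro rfl
    exact hi hj

theorem exists_erase_of_not_radoCondition_update [DecidableEq ι] {A : ι → Submodule K V}
    (hA : RadoCondition A) {i : ι} {B : Submodule K V}
    (hB : ¬ RadoCondition (Function.update A i B)) :
    ∃ F : Finset ι, i ∉ F ∧ finrank K (B ⊔ F.sup A : Submodule K V) ≤ F.card := by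
  simp only [RadoCondition, not_forall, not_le] at hB
  obtain ⟨F, hF⟩ := hB
  by_cases hi : i ∈ F
  · refine ⟨F.erase i, F.notMem_erase i, ?_⟩
    rw [← Finset.insert_erase hi, Finset.sup_insert, Function.update_self,
      sup_update_of_notMem A B (F.notMem_erase i),
      Finset.card_insert_of_notMem (F.notMem_erase i)] at hF
    omega
  · rw [sup_update_of_notMem A B hi] at hF
    exact absurd (hA F) (not_le.2 hF)

variable [FiniteDimensional K V]

/-- If one subspace of a family with Rado's condition is the sum of two subspaces, then it can be
replaced by one of the two. The reason is that the dimension is submodular. -/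
theorem RadoCondition.update_or_update [DecidableEq ι] {A : ι → Submodule K V}
    (hA : RadoCondition A) {i : ι} {B C : Submodule K V} (h : A i = B ⊔ C) :
    RadoCondition (Function.update A i B) ∨ RadoCondition (Function.update A i C) := by
  by_contra hcon
  rw [not_or] at hcon
  obtain ⟨F, hiF, hF⟩ := exists_erase_of_not_radoCondition_update hA hcon.1
  obtain ⟨F', hiF', hF'⟩ := exists_erase_of_not_radoCondition_update hA hcon.2
  have h1 := hA (insert i (F ∪ F'))
  have h2 := hA (F ∩ F')
  rw [Finset.card_insert_of_notMem (by simp [hiF, hiF']), Finset.sup_insert, Finset.sup_union, h,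
    show B ⊔ C ⊔ (F.sup A ⊔ F'.sup A) = (B ⊔ F.sup A) ⊔ (C ⊔ F'.sup A) by
      ac_rfl] at h1
  have h3 : F.sup A ⊓ F'.sup A ≤ (B ⊔ F.sup A) ⊓ (C ⊔ F'.sup A) :=
    inf_le_inf le_sup_right le_sup_right
  have h4 : (F ∩ F').sup A ≤ F.sup A ⊓ F'.sup A :=
    le_inf (Finset.sup_mono Finset.inter_subset_left) (Finset.sup_mono Finset.inter_subset_right)
  have h5 := Submodule.finrank_mono (h4.trans h3)
  have h6 := Submodule.finrank_sup_add_finrank_inf_eq (B ⊔ F.sup A) (C ⊔ F'.sup A)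
  have h7 := Finset.card_union_add_card_inter F F'
  omega

/-- **Rado's theorem** for families of subspaces that are spanned by two vectors each: under
Rado's condition one of the two vectors can be chosen for every member of the family, so that the
chosen vectors are linearly independent. -/
theorem RadoCondition.exists_linearIndependent [Finite ι] {u : ι → Fin 2 → V}
    (h : RadoCondition fun i => Submodule.span K {u i 0, u i 1}) :
    ∃ c : ι → Fin 2, LinearIndependent K fun i => u i (c i) := by
  classical
  have := Fintype.ofFinite ι
  have key : ∀ s : Finset ι, ∃ c : ι → Fin 2, RadoCondition fun i =>
      if i ∈ s then Submodule.span K {u i (c i)} else Submodule.span K {u i 0, u i 1} := by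
    intro s
    induction s using Finset.induction_on with
    | empty => exact ⟨0, by simpa using h⟩
    | insert i s hi ih =>
      obtain ⟨c, hc⟩ := ih
      have hsplit := hc.update_or_update (i := i) (B := Submodule.span K {u i 0})
        (C := Submodule.span K {u i 1}) (by
          rw [if_neg hi, ← Submodule.span_union, Set.singleton_union])
      have : ∃ k : Fin 2, RadoCondition (Function.update (fun j =>
          if j ∈ s then Submodule.span K {u j (c j)} else Submodule.span K {u j 0, u j 1}) i
          (Submodule.span K {u i k})) := by
        rcases hsplit with h | h
        exacts [⟨0, h⟩, ⟨1, h⟩]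
      obtain ⟨k, hk⟩ := this
      refine ⟨Function.update c i k, ?_⟩
      convert hk using 1
      funext j
      by_cases hj : j = i
      · subst hj
        simp
      · simp [hj]
  obtain ⟨c, hc⟩ := key Finset.univ
  simp only [Finset.mem_univ, if_true] at hc
  refine ⟨c, linearIndependent_iff_card_le_finrank_span.2 ?_⟩
  have := hc Finset.univ
  rw [Finset.card_univ] at this
  refine this.trans (Submodule.finrank_mono (Finset.sup_le fun i _ => ?_))
  exact Submodule.span_mono (by rintro _ rfl; exact ⟨i, rfl⟩)

end Rado

section Generic

variable {σ ι K U : Type*} [Field K] [AddCommGroup U] [Module K U]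

/-- The common zeros of the functionals `u i k` with `i ∈ F`. -/
def commonZeros (u : ι → Fin 2 → Dual K U) (F : Finset ι) : Submodule K U where
  carrier := {w | ∀ i ∈ F, ∀ k, u i k w = 0}
  add_mem' ha hb i hi k := by rw [map_add, ha i hi k, hb i hi k, add_zero]
  zero_mem' i _ k := map_zero _
  smul_mem' a _ hw i hi k := by rw [map_smul, hw i hi k, smul_zero]

theorem mem_commonZeros {u : ι → Fin 2 → Dual K U} {F : Finset ι} {w : U} :
    w ∈ commonZeros u F ↔ ∀ i ∈ F, ∀ k, u i k w = 0 := Iff.rfl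

theorem dualCoannihilator_sup_span (u : ι → Fin 2 → Dual K U) (F : Finset ι) :
    (F.sup fun i => Submodule.span K {u i 0, u i 1}).dualCoannihilator = commonZeros u F := by
  ext w
  rw [Submodule.mem_dualCoannihilator, mem_commonZeros]
  constructor
  · intro h i hi k
    refine h _ (Finset.le_sup (f := fun i => Submodule.span K {u i 0, u i 1}) hi
      (Submodule.subset_span ?_))
    fin_cases k <;> simp
  · intro h φ hφ
    have : F.sup (fun i => Submodule.span K {u i 0, u i 1}) ≤
        LinearMap.ker (Dual.eval K U w) := by
      refine Finset.sup_le fun i hi => ?_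
      rw [Submodule.span_le]
      rintro _ (rfl | rfl)
      exacts [h i hi 0, h i hi 1]
    exact this hφ

/-- The combinations of pairs of functionals with coefficients `c`. -/
def combination (u : ι → Fin 2 → Dual K U) (c : ι × Fin 2 → K) (i : ι) : Dual K U :=
  c (i, 0) • u i 0 + c (i, 1) • u i 1

/-- The space on which all the combinations with coefficients `c` vanish. -/
def solutions (u : ι → Fin 2 → Dual K U) (c : ι × Fin 2 → K) : Submodule K U :=
  (Submodule.span K (Set.range (combination u c))).dualCoannihilator

theorem mem_solutions {u : ι → Fin 2 → Dual K U} {c : ι × Fin 2 → K} {w : U} :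
    w ∈ solutions u c ↔ ∀ i, combination u c i w = 0 := by
  rw [solutions, ← SetLike.mem_coe, Submodule.coe_dualCoannihilator_span]
  simp

variable [FiniteDimensional K U]

theorem exists_dual_family [DecidableEq ι] {x : ι → Dual K U} (hx : LinearIndependent K x) :
    ∃ w : ι → U, ∀ i j, x i (w j) = if i = j then 1 else 0 := by
  choose w hw using fun j : ι => (evalEquiv K U).surjective
    ((Basis.span hx).coord j |>.exists_extend.choose)
  have hw' : ∀ j, ∀ y : Submodule.span K (Set.range x), (y : Dual K U) (w j)
      = (Basis.span hx).coord j y := fun j y => by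
    have := LinearMap.congr_fun ((Basis.span hx).coord j |>.exists_extend.choose_spec) y
    rw [← this, ← hw j]
    rfl
  refine ⟨w, fun i j => ?_⟩
  have := hw' j (Basis.span hx i)
  rw [Basis.span_apply] at this
  rw [this]
  simp [Finsupp.single_apply]

/-- Linear independence is a generic property: if functionals that depend polynomially on
parameters are linearly independent for one value of the parameters, then so they are off the zero
set of a nonzero polynomial. -/
theorem exists_mvPolynomial_linearIndependent [Finite ι] (x : (σ → K) → ι → Dual K U)
    (hx : ∀ i w, ∃ p : MvPolynomial σ K, ∀ c, MvPolynomial.eval c p = x c i w)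
    {c₀ : σ → K} (h₀ : LinearIndependent K (x c₀)) :
    ∃ P : MvPolynomial σ K, P ≠ 0 ∧
      ∀ c, MvPolynomial.eval c P ≠ 0 → LinearIndependent K (x c) := by
  classical
  have := Fintype.ofFinite ι
  obtain ⟨w, hw⟩ := exists_dual_family h₀
  choose p hp using hx
  have heval : ∀ c, MvPolynomial.eval c (Matrix.of fun i j => p i (w j)).det
      = (Matrix.of fun i j => x c i (w j)).det := fun c => by
    rw [RingHom.map_det]
    congr 1
    ext i j
    simp [hp]
  refine ⟨(Matrix.of fun i j => p i (w j)).det, ?_, fun c hc => ?_⟩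
  · intro h
    have h1 := heval c₀
    rw [h, map_zero, show (Matrix.of fun i j => x c₀ i (w j)) = 1 by
      ext i j
      simp [hw, Matrix.one_apply], Matrix.det_one] at h1
    exact zero_ne_one h1
  · rw [heval] at hc
    have hrows := Matrix.linearIndependent_rows_of_det_ne_zero hc
    let T : Dual K U →ₗ[K] ι → K := LinearMap.pi fun j => Dual.eval K U (w j)
    exact LinearIndependent.of_comp T hrows

theorem finrank_sup_span_add_finrank_commonZeros (u : ι → Fin 2 → Dual K U) (F : Finset ι) :
    finrank K (F.sup fun i => Submodule.span K {u i 0, u i 1} : Submodule K (Dual K U)) +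
      finrank K (commonZeros u F) = finrank K U := by
  rw [← dualCoannihilator_sup_span]
  exact Subspace.finrank_add_finrank_dualCoannihilator_eq _

theorem finrank_le_finrank_solutions [Fintype ι] (u : ι → Fin 2 → Dual K U) (c : ι × Fin 2 → K) :
    finrank K U ≤ Fintype.card ι + finrank K (solutions u c) := by
  rw [solutions, ← Subspace.finrank_add_finrank_dualCoannihilator_eq
    (Submodule.span K (Set.range (combination u c)))]
  gcongr
  exact finrank_range_le_card _

/-- Generic form of Rado's theorem: under Rado's condition, generic combinations of the pairs of
functionals are linearly independent. -/
theorem exists_mvPolynomial_combination (u : ι → Fin 2 → Dual K U) (F₀ : Finset ι)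
    (h : ∀ F ⊆ F₀, F.card + finrank K (commonZeros u F) ≤ finrank K U) :
    ∃ P : MvPolynomial (ι × Fin 2) K, P ≠ 0 ∧ ∀ c, MvPolynomial.eval c P ≠ 0 →
      LinearIndependent K fun i : F₀ => combination u c i := by
  classical
  have hR : RadoCondition fun i : F₀ => Submodule.span K {u i 0, u i 1} := fun F => by
    have h1 := h (F.map (Function.Embedding.subtype _)) (by
      intro i hi
      obtain ⟨j, -, rfl⟩ := Finset.mem_map.1 hi
      exact j.2)
    have h2 := finrank_sup_span_add_finrank_commonZeros u (F.map (Function.Embedding.subtype _))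
    rw [Finset.sup_map] at h2
    rw [Finset.card_map] at h1
    have h3 : F.card ≤ finrank K (F.sup ((fun i => Submodule.span K {u i 0, u i 1}) ∘
      (Function.Embedding.subtype (· ∈ F₀))) : Submodule K (Dual K U)) := by omega
    exact h3
  obtain ⟨k, hk⟩ := RadoCondition.exists_linearIndependent (u := fun i : F₀ => u i) hR
  let k' : ι → Fin 2 := fun i => if hi : i ∈ F₀ then k ⟨i, hi⟩ else 0
  refine exists_mvPolynomial_linearIndependent (fun c (i : F₀) => combination u c i)
    (fun i w => ⟨MvPolynomial.X ((i : ι), (0 : Fin 2)) * MvPolynomial.C (u i 0 w) +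
      MvPolynomial.X ((i : ι), (1 : Fin 2)) * MvPolynomial.C (u i 1 w), fun c => by simp [combination]⟩)
    (c₀ := fun x => if x.2 = k' x.1 then 1 else 0) ?_
  have heq : (fun i : F₀ => combination u (fun x => if x.2 = k' x.1 then 1 else 0) i) =
      fun i : F₀ => u i (k i) := by
    funext i
    have : k' i = k i := by simp [k']
    simp only [combination, this]
    generalize k i = l
    fin_cases l <;> simp
  rw [heq]
  exact hk

/-- If Rado's condition holds with one dimension to spare, then it still holds for the
restrictions to a hyperplane. Hence no hyperplane contains the solutions for generic
coefficients. -/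
theorem exists_mvPolynomial_solutions [Fintype ι] {u : ι → Fin 2 → Dual K U}
    (h : ∀ F : Finset ι, F.Nonempty → F.card + 1 + finrank K (commonZeros u F) ≤ finrank K U)
    {y : Dual K U} (hy : y ≠ 0) :
    ∃ P : MvPolynomial (ι × Fin 2) K, P ≠ 0 ∧ ∀ c, MvPolynomial.eval c P ≠ 0 →
      finrank K (solutions u c) + Fintype.card ι = finrank K U ∧ ∃ w ∈ solutions u c, y w ≠ 0 := by
  have hyker := Dual.finrank_ker_add_one_of_ne_zero hy
  let u' : ι → Fin 2 → Dual K (LinearMap.ker y) := fun i k => u i k ∘ₗ (LinearMap.ker y).subtype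
  have hcomap : ∀ F, commonZeros u' F = (commonZeros u F).comap (LinearMap.ker y).subtype :=
    fun F => rfl
  obtain ⟨P, hP, hP'⟩ := exists_mvPolynomial_combination u' Finset.univ fun F _ => by
    rcases F.eq_empty_or_nonempty with rfl | hF
    · rw [Finset.card_empty, zero_add]
      exact Submodule.finrank_le _
    · have h1 := h F hF
      have h2 : finrank K (commonZeros u' F) ≤ finrank K (commonZeros u F) := by
        rw [hcomap, ← Submodule.finrank_map_subtype_eq]
        exact Submodule.finrank_mono (Submodule.map_comap_le _ _)
      omega
  refine ⟨P, hP, fun c hc => ?_⟩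
  have hli : LinearIndependent K (combination u' c) := by
    have := (hP' c hc).comp (fun i : ι => ⟨i, Finset.mem_univ i⟩) fun i j hij => by
      simpa using hij
    exact this
  have h1 := Subspace.finrank_add_finrank_dualCoannihilator_eq
    (Submodule.span K (Set.range (combination u' c)))
  rw [finrank_span_eq_card hli] at h1
  change _ + finrank K (solutions u' c) = _ at h1
  have h2 : solutions u' c = (solutions u c).comap (LinearMap.ker y).subtype := by
    ext w
    rw [Submodule.mem_comap, mem_solutions, mem_solutions]
    rfl
  rw [h2, ← Submodule.finrank_map_subtype_eq, Submodule.map_comap_subtype] at h1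
  have h3 := finrank_le_finrank_solutions u c
  have hnot : ¬ solutions u c ≤ LinearMap.ker y := fun hle => by
    rw [inf_eq_right.2 hle] at h1
    omega
  refine ⟨?_, ?_⟩
  · have h4 := Submodule.finrank_sup_add_finrank_inf_eq (LinearMap.ker y) (solutions u c)
    have h5 := Submodule.finrank_le (LinearMap.ker y ⊔ solutions u c)
    omega
  · simpa [SetLike.not_le_iff_exists] using hnot

/-- If Rado's condition does not hold with one dimension to spare, then a minimal violating set
of pairs has as many members as its span has dimensions, and generic combinations of the pairs
span that space. -/
theorem exists_mvPolynomial_solutions_le {u : ι → Fin 2 → Dual K U}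
    (h : ∃ F : Finset ι, F.Nonempty ∧ finrank K U < F.card + 1 + finrank K (commonZeros u F)) :
    ∃ F : Finset ι, F.Nonempty ∧ ∃ P : MvPolynomial (ι × Fin 2) K, P ≠ 0 ∧
      ∀ c, MvPolynomial.eval c P ≠ 0 → solutions u c ≤ commonZeros u F := by
  classical
  obtain ⟨F, ⟨hF, hcard⟩, hmin⟩ := WellFounded.has_min (wellFounded_lt (α := Finset ι))
    {F | F.Nonempty ∧ finrank K U < F.card + 1 + finrank K (commonZeros u F)} h
  refine ⟨F, hF, ?_⟩
  by_cases htop : commonZeros u F = ⊤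
  · exact ⟨1, one_ne_zero, fun c _ => htop ▸ le_top⟩
  have hmin' : ∀ F' ⊂ F, F'.card + finrank K (commonZeros u F') ≤ finrank K U := fun F' hF' => by
    rcases F'.eq_empty_or_nonempty with rfl | hne
    · rw [Finset.card_empty, zero_add]
      exact Submodule.finrank_le _
    · by_contra hcon
      exact hmin F' ⟨hne, by omega⟩ hF'
  have hself : F.card + finrank K (commonZeros u F) ≤ finrank K U := by
    obtain ⟨i, hi⟩ := hF
    rcases (F.erase i).eq_empty_or_nonempty with h0 | hne
    · have h1 := Finset.card_erase_add_one hi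
      rw [h0, Finset.card_empty] at h1
      have h2 := Submodule.finrank_lt (lt_top_iff_ne_top.2 htop).ne
      omega
    · have h1 : ¬ finrank K U < (F.erase i).card + 1 + finrank K (commonZeros u (F.erase i)) :=
        fun hlt => hmin _ ⟨hne, hlt⟩ (Finset.erase_ssubset hi)
      have h2 := Finset.card_erase_add_one hi
      have h3 : finrank K (commonZeros u F) ≤ finrank K (commonZeros u (F.erase i)) :=
        Submodule.finrank_mono fun w hw j hj => hw j (Finset.mem_of_mem_erase hj)
      omega
  obtain ⟨P, hP, hP'⟩ := exists_mvPolynomial_combination u F fun F' hF' => by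
    rcases hF'.eq_or_ssubset with rfl | hss
    exacts [hself, hmin' F' hss]
  refine ⟨P, hP, fun c hc => ?_⟩
  have hli := hP' c hc
  have hle : Submodule.span K (Set.range fun i : F => combination u c i) ≤
      F.sup fun i => Submodule.span K {u i 0, u i 1} := by
    rw [Submodule.span_le]
    rintro _ ⟨i, rfl⟩
    refine Finset.le_sup (f := fun i => Submodule.span K {u i 0, u i 1}) i.2 ?_
    exact Submodule.add_mem _ (Submodule.smul_mem _ _ (Submodule.subset_span (by simp)))
      (Submodule.smul_mem _ _ (Submodule.subset_span (by simp)))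
  have heq := Submodule.eq_of_le_of_finrank_le hle (by
    rw [finrank_span_eq_card hli, Fintype.card_coe]
    have := finrank_sup_span_add_finrank_commonZeros u F
    omega)
  rw [← dualCoannihilator_sup_span, ← heq]
  refine Submodule.dualCoannihilator_anti (Submodule.span_mono ?_)
  rintro _ ⟨i, rfl⟩
  exact ⟨i, rfl⟩

end Generic

end Crystal

/-! ### Cocycles, and representations with prescribed rotational parts -/

namespace Crystal

open Module

section Cocycles

variable {Γ : Type*} [Group Γ]

/-- The cocycles `τ : Γ → ℂ` for the action of `Γ` on the plane through the rotations `r`. They are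
the vectors `τ γ = Φ γ 0` of the representations `Φ` of `Γ` with rotational parts `r`. -/
def cocycles (r : Γ →* Circle) : Submodule ℝ (Γ → ℂ) where
  carrier := {τ | ∀ γ δ, τ (γ * δ) = τ γ + r γ * τ δ}
  add_mem' {a b} ha hb γ δ := by
    simp only [Pi.add_apply, ha γ δ, hb γ δ]
    ring
  zero_mem' γ δ := by simp
  smul_mem' c a ha γ δ := by
    simp only [Pi.smul_apply, ha γ δ, Complex.real_smul]
    ring

variable {r : Γ →* Circle} {τ τ₀ : Γ → ℂ}

theorem cocycle_one (hτ : τ ∈ cocycles r) : τ 1 = 0 := by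
  have := hτ 1 1
  simpa using this

theorem cocycle_conj (hτ : τ ∈ cocycles r) (γ : Γ) {l : Γ} (hl : r l = 1) :
    τ (γ * l * γ⁻¹) = r γ * τ l := by
  have h1 := hτ (γ * l * γ⁻¹) γ
  have h2 := hτ γ l
  rw [inv_mul_cancel_right, h2] at h1
  simp only [map_mul, map_inv, hl, mul_one, mul_inv_cancel, Circle.coe_one, one_mul] at h1
  linear_combination -h1

/-- Complex multiples of a cocycle are cocycles, since rotations of the plane about the origin
commute. -/
theorem mul_mem_cocycles (hτ : τ ∈ cocycles r) (c : ℂ) : (fun γ => c * τ γ) ∈ cocycles r :=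
  fun γ δ => by
    simp only [hτ γ δ]
    ring

/-- The translations in a subgroup vanish under a cocycle if and only if the subgroup has a
common fixed point. If `h` is a rotation in the subgroup, then its center is the fixed point: every
other element `g` commutes with `h` up to a translation, and so it fixes the center of `h`. -/
theorem exists_fixed_iff (hτ : τ ∈ cocycles r) (H : Subgroup Γ) :
    (∃ q : ℂ, ∀ g ∈ H, r g * q + τ g = q) ↔ ∀ g ∈ H, r g = 1 → τ g = 0 := by
  constructor
  · rintro ⟨q, hq⟩ g hg h1
    have := hq g hg
    rw [h1, Circle.coe_one] at this
    linear_combination this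
  · intro h0
    by_cases hr : ∀ g ∈ H, r g = 1
    · exact ⟨0, fun g hg => by simp [h0 g hg (hr g hg)]⟩
    push Not at hr
    obtain ⟨h, hh, hr⟩ := hr
    have hne : (1 - r h : ℂ) ≠ 0 := fun h => hr (Circle.coe_injective (by
      rw [Circle.coe_one]
      linear_combination -h))
    refine ⟨τ h / (1 - r h), fun g hg => ?_⟩
    have hcomm : τ (g * h * g⁻¹ * h⁻¹) = 0 := by
      apply h0
      · exact H.mul_mem (H.mul_mem (H.mul_mem hg hh) (H.inv_mem hg)) (H.inv_mem hh)
      · simp only [map_mul, map_inv]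
        rw [mul_comm (r g) (r h), mul_inv_cancel_right, mul_inv_cancel]
    have h1 := hτ (g * h * g⁻¹ * h⁻¹) (h * g)
    rw [show g * h * g⁻¹ * h⁻¹ * (h * g) = g * h by group, hcomm, hτ g h, hτ h g,
      show r (g * h * g⁻¹ * h⁻¹) = 1 by
        simp only [map_mul, map_inv]
        rw [mul_comm (r g) (r h), mul_inv_cancel_right, mul_inv_cancel]] at h1
    simp only [Circle.coe_one] at h1
    field_simp
    linear_combination h1

variable (r) in
/-- The cocycle of the representation by rotations about `q`; this is the effect on the
trivial cocycle of moving the origin of the plane. -/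
noncomputable def coboundary : ℂ →ₗ[ℝ] cocycles r where
  toFun q := ⟨fun γ => q - r γ * q, fun γ δ => by
    simp only [map_mul, Circle.coe_mul]
    ring⟩
  map_add' a b := by
    ext γ
    simp only [Submodule.coe_add, Pi.add_apply]
    ring
  map_smul' c a := by
    ext γ
    simp only [Submodule.coe_smul, Pi.smul_apply, Complex.real_smul, RingHom.id_apply]
    ring

@[simp]
theorem coboundary_apply (q : ℂ) (γ : Γ) : (coboundary r q : Γ → ℂ) γ = q - r γ * q := rfl

variable (r) in
/-- The cocycles that vanish on a subgroup. -/
def vanishing (H : Subgroup Γ) : Submodule ℝ (cocycles r) where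
  carrier := {τ | ∀ g ∈ H, (τ : Γ → ℂ) g = 0}
  add_mem' ha hb g hg := by simp [ha g hg, hb g hg]
  zero_mem' g hg := rfl
  smul_mem' c a ha g hg := by simp [ha g hg]

theorem mem_vanishing {H : Subgroup Γ} {τ : cocycles r} :
    τ ∈ vanishing r H ↔ ∀ g ∈ H, (τ : Γ → ℂ) g = 0 := Iff.rfl

theorem vanishing_ker : vanishing r r.ker = LinearMap.range (coboundary r) := by
  ext τ
  have h := exists_fixed_iff τ.2 ⊤
  simp only [Subgroup.mem_top, forall_const] at h
  rw [mem_vanishing, LinearMap.mem_range]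
  simp only [MonoidHom.mem_ker]
  rw [← h]
  refine exists_congr fun q => ?_
  rw [Subtype.ext_iff, funext_iff]
  refine forall_congr' fun γ => ?_
  rw [coboundary_apply]
  constructor <;> intro h <;> linear_combination -h

/-- The conditions on a cocycle that make its representation discrete and faithful. -/
structure IsDiscreteCocycle (r : Γ →* Circle) (τ : Γ → ℂ) : Prop where
  mem : τ ∈ cocycles r
  eq_one : ∀ γ, r γ = 1 → τ γ = 0 → γ = 1
  finite : ∀ R : ℝ, {γ : Γ | ‖τ γ‖ ≤ R}.Finite

/-- The group of translations, as a subgroup of the plane. -/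
def translLattice (h : τ₀ ∈ cocycles r) : AddSubgroup ℂ where
  carrier := {z | ∃ γ, r γ = 1 ∧ τ₀ γ = z}
  add_mem' := by
    rintro _ _ ⟨γ, hγ, rfl⟩ ⟨δ, hδ, rfl⟩
    exact ⟨γ * δ, by simp [hγ, hδ], by simp [h γ δ, hγ]⟩
  zero_mem' := ⟨1, by simp, cocycle_one h⟩
  neg_mem' := by
    rintro _ ⟨γ, hγ, rfl⟩
    refine ⟨γ⁻¹, by simp [hγ], ?_⟩
    have := h γ γ⁻¹
    rw [mul_inv_cancel, cocycle_one h, hγ, Circle.coe_one] at this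
    linear_combination -this

theorem IsDiscreteCocycle.discreteTopology (h : IsDiscreteCocycle r τ₀) :
    DiscreteTopology (AddSubgroup.toIntSubmodule (translLattice h.mem)) := by
  set L := AddSubgroup.toIntSubmodule (translLattice h.mem)
  have hfin : (Metric.ball (0 : ℂ) 1 ∩ L).Finite := by
    refine ((h.finite 1).image τ₀).subset ?_
    rintro z ⟨hz, γ, -, rfl⟩
    refine ⟨γ, ?_, rfl⟩
    simpa using (mem_ball_zero_iff.1 hz).le
  rw [discreteTopology_iff_isOpen_singleton_zero]
  refine ⟨Metric.ball 0 1 ∩ ((Metric.ball (0 : ℂ) 1 ∩ L) \ {0})ᶜ,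
    Metric.isOpen_ball.inter (hfin.subset Set.sdiff_subset).isClosed.isOpen_compl, ?_⟩
  ext z
  simp only [Set.mem_preimage, Set.mem_inter_iff, Set.mem_compl_iff, Set.mem_sdiff,
    Set.mem_singleton_iff, not_and, not_not, SetLike.mem_coe]
  constructor
  · rintro ⟨h1, h2⟩
    exact Subtype.ext (h2 ⟨h1, z.2⟩)
  · rintro rfl
    simp

theorem linearIndependent_real_of_discrete (L : Submodule ℤ ℂ) [DiscreteTopology L] {ι : Type*}
    [Fintype ι] (b : Basis ι ℤ L) : LinearIndependent ℝ fun i => (b i : ℂ) := by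
  have hspan : Submodule.span ℤ (Set.range fun i => (b i : ℂ)) = L := by
    rw [show (fun i => (b i : ℂ)) = L.subtype ∘ b from rfl, Set.range_comp, ← Submodule.map_span,
      b.span_eq, Submodule.map_top, Submodule.range_subtype]
  rw [linearIndependent_iff_card_eq_finrank_span,
    Real.finrank_eq_int_finrank_of_discrete (by rw [hspan]; infer_instance), Set.finrank, hspan,
    finrank_eq_card_basis b]

/-- On translations, every cocycle is a linear image of a discrete one, since `ℤ`-independent
vectors of a discrete group are `ℝ`-independent. -/
theorem IsDiscreteCocycle.exists_linearMap (h : IsDiscreteCocycle r τ₀) (hτ : τ ∈ cocycles r) :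
    ∃ A : ℂ →ₗ[ℝ] ℂ, ∀ γ, r γ = 1 → τ γ = A (τ₀ γ) := by
  have := h.discreteTopology
  set L := AddSubgroup.toIntSubmodule (translLattice h.mem) with hL
  choose g hg1 hg using fun z : L => z.2
  have hinj : ∀ γ δ, r γ = 1 → r δ = 1 → τ₀ γ = τ₀ δ → γ = δ := fun γ δ hγ hδ heq => by
    have h1 := h.mem (γ * δ⁻¹) δ
    rw [inv_mul_cancel_right] at h1
    have h2 : r (γ * δ⁻¹) = 1 := by simp [hγ, hδ]
    rw [h2, heq, Circle.coe_one] at h1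
    exact mul_inv_eq_one.1 (h.eq_one _ h2 (by linear_combination -h1))
  let φ : L →+ ℂ := AddMonoidHom.mk' (fun z => τ (g z)) fun a b => by
    have : g (a + b) = g a * g b := hinj _ _ (hg1 _) (by simp [hg1]) (by
      rw [h.mem, hg, hg, hg, hg1]
      simp)
    rw [this, hτ, hg1]
    simp
  let b := Free.chooseBasis ℤ L
  have hli := linearIndependent_real_of_discrete L b
  obtain ⟨A, hA⟩ := ((Basis.span hli).constr ℝ fun i => φ (b i)).exists_extend
  refine ⟨A, fun γ hγ => ?_⟩
  have hAb : ∀ i, A (b i) = φ (b i) := fun i => by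
    have := LinearMap.congr_fun hA (Basis.span hli i)
    rw [Basis.constr_basis, LinearMap.comp_apply, Submodule.subtype_apply, Basis.span_apply] at this
    exact this
  have hAφ : A.toAddMonoidHom.toIntLinearMap ∘ₗ L.subtype = φ.toIntLinearMap :=
    b.ext hAb
  have := LinearMap.congr_fun hAφ ⟨τ₀ γ, γ, hγ, rfl⟩
  have hgγ : g ⟨τ₀ γ, γ, hγ, rfl⟩ = γ := hinj _ _ (hg1 _) hγ (hg _)
  calc τ γ = φ ⟨τ₀ γ, γ, hγ, rfl⟩ := by
        change _ = τ (g _)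
        rw [hgγ]
    _ = A (τ₀ γ) := this.symm

theorem IsDiscreteCocycle.finiteDimensional (h : IsDiscreteCocycle r τ₀) :
    FiniteDimensional ℝ (cocycles r) := by
  let res : cocycles r →ₗ[ℝ] (r.ker → ℂ) :=
    LinearMap.funLeft ℝ ℂ ((↑) : r.ker → Γ) ∘ₗ (cocycles r).subtype
  let ev : (ℂ →ₗ[ℝ] ℂ) →ₗ[ℝ] (r.ker → ℂ) := LinearMap.pi fun γ => LinearMap.applyₗ (τ₀ γ)
  have hrange : LinearMap.range res ≤ LinearMap.range ev := by
    rintro _ ⟨τ, rfl⟩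
    obtain ⟨A, hA⟩ := h.exists_linearMap τ.2
    exact ⟨A, funext fun γ => (hA γ γ.2).symm⟩
  have hker : LinearMap.ker res = LinearMap.range (coboundary r) := by
    rw [← vanishing_ker]
    ext τ
    simp [res, mem_vanishing, funext_iff, LinearMap.funLeft]
  have h1 : FiniteDimensional ℝ (LinearMap.range res) :=
    Submodule.finiteDimensional_of_le hrange
  refine ⟨Submodule.fg_of_fg_map_of_fg_inf_ker res ?_ ?_⟩
  · rw [Submodule.map_top]
    exact (Submodule.fg_top _).1 h1.fg_top
  · rw [top_inf_eq, hker]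
    exact Module.Finite.iff_fg.1 inferInstance

/-- A cocompact group of rotations and translations has a nonzero translation: without one, all
rotations would have the same center. -/
theorem exists_translation_ne_zero (hτ : τ₀ ∈ cocycles r)
    (hco : ∃ R : ℝ, ∀ x : ℂ, ∃ γ : Γ, dist (τ₀ γ) x ≤ R) : ∃ γ, r γ = 1 ∧ τ₀ γ ≠ 0 := by
  by_contra! hcon
  obtain ⟨q, hq⟩ := (exists_fixed_iff hτ ⊤).2 fun g _ hg => hcon g hg
  obtain ⟨R, hR⟩ := hco
  obtain ⟨γ, hγ⟩ := hR ((2 * ‖q‖ + |R| + 1 : ℝ) : ℂ)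
  have h1 : ‖τ₀ γ‖ ≤ 2 * ‖q‖ := by
    have : τ₀ γ = q - r γ * q := by linear_combination hq γ trivial
    rw [this]
    refine (norm_sub_le _ _).trans ?_
    rw [norm_mul, Circle.norm_coe]
    linarith
  have h2 : ‖((2 * ‖q‖ + |R| + 1 : ℝ) : ℂ)‖ = 2 * ‖q‖ + |R| + 1 := by
    rw [Complex.norm_real, Real.norm_of_nonneg (by positivity)]
  have h3 := norm_sub_norm_le ((2 * ‖q‖ + |R| + 1 : ℝ) : ℂ) (τ₀ γ)
  rw [dist_comm, dist_eq_norm] at hγ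
  linarith [le_abs_self R]

theorem IsDiscreteCocycle.finite_range (h : IsDiscreteCocycle r τ₀)
    (hne : ∃ γ, r γ = 1 ∧ τ₀ γ ≠ 0) : (Set.range r).Finite := by
  obtain ⟨l, hl, hne⟩ := hne
  have hfin := (h.finite ‖τ₀ l‖).image fun γ => τ₀ γ / τ₀ l
  refine Set.Finite.of_finite_image (f := ((↑) : Circle → ℂ)) (hfin.subset ?_)
    Circle.coe_injective.injOn
  rintro _ ⟨_, ⟨γ, rfl⟩, rfl⟩
  refine ⟨γ * l * γ⁻¹, ?_, ?_⟩
  · rw [Set.mem_ofPred_eq, cocycle_conj h.mem γ hl, norm_mul, Circle.norm_coe, one_mul]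
  · simp only [cocycle_conj h.mem γ hl]
    field_simp

/-- Every direction in the space of cocycles leads from a discrete cocycle to other discrete
cocycles. -/
theorem IsDiscreteCocycle.exists_add_smul (h : IsDiscreteCocycle r τ₀)
    (hne : ∃ γ, r γ = 1 ∧ τ₀ γ ≠ 0) (hτ : τ ∈ cocycles r) :
    ∃ ε : ℝ, ε ≠ 0 ∧ IsDiscreteCocycle r (τ₀ + ε • τ) := by
  obtain ⟨A, hA⟩ := h.exists_linearMap hτ
  let A' : ℂ →L[ℝ] ℂ := LinearMap.toContinuousLinearMap A
  set ε : ℝ := 1 / (2 * (‖A'‖ + 1))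
  have hε : 0 < ε := by positivity
  have hεA : ε * ‖A'‖ ≤ 1 / 2 := by
    rw [div_mul_eq_mul_div, div_le_div_iff₀ (by positivity) (by norm_num)]
    nlinarith [norm_nonneg A']
  have hmem : τ₀ + ε • τ ∈ cocycles r :=
    Submodule.add_mem _ h.mem (Submodule.smul_mem _ _ hτ)
  have hbound : ∀ γ, r γ = 1 → ‖τ₀ γ‖ ≤ 2 * ‖(τ₀ + ε • τ) γ‖ := fun γ hγ => by
    have h1 : ‖(ε • τ) γ‖ ≤ 1 / 2 * ‖τ₀ γ‖ := by
      rw [Pi.smul_apply, hA γ hγ, norm_smul, Real.norm_of_nonneg hε.le]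
      calc ε * ‖A (τ₀ γ)‖ ≤ ε * (‖A'‖ * ‖τ₀ γ‖) :=
            mul_le_mul_of_nonneg_left (A'.le_opNorm _) hε.le
        _ = ε * ‖A'‖ * ‖τ₀ γ‖ := by ring
        _ ≤ _ := mul_le_mul_of_nonneg_right hεA (norm_nonneg _)
    have h2 := norm_sub_le ((τ₀ + ε • τ) γ) ((ε • τ) γ)
    rw [Pi.add_apply, add_sub_cancel_right] at h2
    rw [Pi.add_apply]
    linarith
  refine ⟨ε, hε.ne', hmem, fun γ hγ h0 => h.eq_one γ hγ ?_, fun R => ?_⟩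
  · have := hbound γ hγ
    rw [h0, norm_zero, mul_zero] at this
    exact norm_le_zero_iff.1 this
  · -- `g` picks one element of `Γ` for each of the finitely many rotational parts
    choose g hg using fun x : Set.range r => x.2
    have := (h.finite_range hne).to_subtype
    refine (Set.finite_iUnion fun x : Set.range r =>
      (h.finite (2 * (R + ‖(τ₀ + ε • τ) (g x)‖))).image fun l => l * g x).subset ?_
    intro γ hγ
    refine Set.mem_iUnion.2 ⟨⟨r γ, Set.mem_range_self γ⟩, γ * (g ⟨r γ, Set.mem_range_self γ⟩)⁻¹, ?_, by simp⟩
    have hr : r (γ * (g ⟨r γ, Set.mem_range_self γ⟩)⁻¹) = 1 := by simp [hg]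
    have h1 := hmem (γ * (g ⟨r γ, Set.mem_range_self γ⟩)⁻¹) (g ⟨r γ, Set.mem_range_self γ⟩)
    rw [inv_mul_cancel_right, hr, Circle.coe_one, one_mul] at h1
    refine (hbound _ hr).trans (mul_le_mul_of_nonneg_left ?_ zero_le_two)
    rw [eq_sub_iff_add_eq.2 h1.symm]
    exact (norm_sub_le _ _).trans (by gcongr; exact hγ)

end Cocycles

section Representations

variable {Γ : Type*} [Group Γ] {Φ₀ Φ : Γ →* Euc} {r : Γ →* Circle}

/-- The rotational parts of `Φ` are the rotations `r`. -/
def HasRotations (r : Γ →* Circle) (Φ : Γ →* Euc) : Prop :=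
  ∀ (γ : Γ) (z : ℂ), linPart (Φ γ) z = r γ * z

theorem IsCrystallographic.exists_hasRotations (h : IsCrystallographic Φ₀) :
    ∃ r : Γ →* Circle, HasRotations r Φ₀ := by
  choose a ha using h.2.2
  have hinj : Function.Injective rotation := fun x y hxy => by
    have := congrArg (fun f : ℂ ≃ₗᵢ[ℝ] ℂ => f 1) hxy
    exact Circle.coe_injective (by simpa using this)
  refine ⟨MonoidHom.mk' a fun x y => hinj ?_, fun γ z => ?_⟩
  · rw [← ha, map_mul, map_mul, ha, ha, map_mul]
  · rw [ha, rotation_apply]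
    rfl

theorem HasRotations.sameRotations_iff (h : HasRotations r Φ₀) :
    SameRotations Φ₀ Φ ↔ HasRotations r Φ := by
  refine forall_congr' fun γ => ?_
  rw [LinearIsometryEquiv.ext_iff]
  exact forall_congr' fun z => by rw [h γ z]

theorem HasRotations.apply (h : HasRotations r Φ) (γ : Γ) (z : ℂ) : Φ γ z = r γ * z + Φ γ 0 := by
  have := (Φ γ).map_vadd 0 z
  rw [vadd_eq_add, add_zero] at this
  rw [this, vadd_eq_add, ← h γ z]
  rfl

theorem HasRotations.mem_cocycles (h : HasRotations r Φ) : (fun γ => Φ γ 0) ∈ cocycles r :=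
  fun γ δ => by
    change Φ (γ * δ) 0 = Φ γ 0 + r γ * Φ δ 0
    rw [map_mul, add_comm, ← h.apply γ (Φ δ 0)]
    rfl

theorem HasRotations.mem_transl (h : HasRotations r Φ₀) {γ : Γ} : γ ∈ transl Φ₀ ↔ r γ = 1 := by
  rw [transl, MonoidHom.mem_ker, LinearIsometryEquiv.ext_iff]
  constructor
  · intro h1
    have := h1 1
    rw [MonoidHom.comp_apply, h γ 1] at this
    exact Circle.coe_injective (by simpa using this)
  · intro h1 z
    rw [MonoidHom.comp_apply, h γ z, h1]
    simp

theorem HasRotations.transl_eq (h : HasRotations r Φ₀) : transl Φ₀ = r.ker := by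
  ext γ
  rw [h.mem_transl, MonoidHom.mem_ker]

theorem HasRotations.eq_one_iff (h : HasRotations r Φ) {γ : Γ} :
    Φ γ = 1 ↔ r γ = 1 ∧ Φ γ 0 = 0 := by
  constructor
  · intro h1
    have h0 : Φ γ 0 = 0 := by rw [h1]; rfl
    refine ⟨?_, h0⟩
    have := h.apply γ 1
    rw [h0, h1] at this
    exact Circle.coe_injective (by simpa using this.symm)
  · rintro ⟨h1, h0⟩
    ext z
    rw [h.apply, h1, h0]
    simp

/-- The representation with rotational parts `r` and translational parts `τ`. -/
noncomputable def ofCocycle {τ : Γ → ℂ} (hτ : τ ∈ cocycles r) : Γ →* Euc :=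
  MonoidHom.mk' (fun γ => (rotation (r γ)).toAffineIsometryEquiv.trans
    (AffineIsometryEquiv.constVAdd ℝ ℂ (τ γ))) fun γ δ => by
      ext z
      simp [hτ γ δ]
      ring

theorem ofCocycle_apply {τ : Γ → ℂ} (hτ : τ ∈ cocycles r) (γ : Γ) (z : ℂ) :
    ofCocycle hτ γ z = r γ * z + τ γ := by
  simp [ofCocycle, add_comm]

theorem hasRotations_ofCocycle {τ : Γ → ℂ} (hτ : τ ∈ cocycles r) :
    HasRotations r (ofCocycle hτ) := fun γ z =>
  rotation_apply (r γ) z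

theorem HasRotations.isDiscreteFaithful_iff (h : HasRotations r Φ) :
    IsDiscreteFaithful Φ ↔ IsDiscreteCocycle r fun γ => Φ γ 0 := by
  rw [IsDiscreteFaithful, injective_iff_map_eq_one]
  simp only [h.eq_one_iff]
  exact ⟨fun h' => ⟨h.mem_cocycles, fun γ h1 h2 => h'.1 γ ⟨h1, h2⟩, h'.2⟩,
    fun h' => ⟨fun γ h1 => h'.eq_one γ h1.1 h1.2, h'.finite⟩⟩

/-- The discrete faithful representations span all representations. Hence `rep` is the rank of
the restriction of cocycles to the subgroup. -/
theorem IsCrystallographic.rep_add_finrank_vanishing (hΓ : IsCrystallographic Φ₀)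
    (h : HasRotations r Φ₀) (H : Subgroup Γ) :
    rep Φ₀ H + finrank ℝ (vanishing r H) = finrank ℝ (cocycles r) := by
  have h₀ := h.isDiscreteFaithful_iff.1 hΓ.1
  have hne := exists_translation_ne_zero h₀.mem hΓ.2.1
  have := h₀.finiteDimensional
  let res : cocycles r →ₗ[ℝ] (H → ℂ) :=
    LinearMap.funLeft ℝ ℂ ((↑) : H → Γ) ∘ₗ (cocycles r).subtype
  have hker : LinearMap.ker res = vanishing r H := by
    ext τ
    simp [res, mem_vanishing, funext_iff, LinearMap.funLeft]
  have hspan : Submodule.span ℝ {τ : H → ℂ | ∃ Φ : Γ →* Euc, IsDiscreteFaithful Φ ∧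
      SameRotations Φ₀ Φ ∧ ∀ h : H, τ h = Φ h 0} = LinearMap.range res := by
    have hmem : ∀ τ : cocycles r, IsDiscreteCocycle r τ → res τ ∈ {τ : H → ℂ | ∃ Φ : Γ →* Euc,
        IsDiscreteFaithful Φ ∧ SameRotations Φ₀ Φ ∧ ∀ h : H, τ h = Φ h 0} := fun τ hτ => by
      have h1 := hasRotations_ofCocycle τ.2
      have h2 : (fun γ => ofCocycle τ.2 γ 0) = τ := by
        funext γ
        simp [ofCocycle_apply]
      refine ⟨ofCocycle τ.2, h1.isDiscreteFaithful_iff.2 (by rwa [h2]),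
        h.sameRotations_iff.2 h1, fun g => ?_⟩
      rw [congrFun h2 g]
      rfl
    apply le_antisymm
    · rw [Submodule.span_le]
      rintro τ ⟨Φ, -, hΦ, hτ⟩
      exact ⟨⟨_, (h.sameRotations_iff.1 hΦ).mem_cocycles⟩, funext fun g => (hτ g).symm⟩
    · rintro _ ⟨τ, rfl⟩
      obtain ⟨ε, hε, hε'⟩ := h₀.exists_add_smul hne τ.2
      have h1 := Submodule.subset_span (R := ℝ) (hmem ⟨_, h₀.mem⟩ h₀)
      have h2 := Submodule.subset_span (R := ℝ) (hmem (⟨_, h₀.mem⟩ + ε • τ) hε')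
      rw [map_add, map_smul] at h2
      exact (Submodule.smul_mem_iff _ hε).1 ((Submodule.add_mem_iff_right _ h1).1 h2)
  rw [rep, hspan, ← hker, LinearMap.finrank_range_add_finrank_ker]

end Representations

end Crystal

/-! ### Collapsed configurations of a colored graph, and the sparsity function -/

namespace Crystal

open Module

section Configurations

variable {Γ V E : Type*} [Group Γ] (r : Γ →* Circle) (G : ColoredGraph Γ V E)

variable (V) in
/-- A configuration: a point for every vertex of the colored graph, and a cocycle. -/
abbrev Configuration : Type _ := (V → ℂ) × cocycles r

/-- The vector in the plane from the tail of the representative of the edge `a` to its head. -/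
noncomputable def edgeVector (a : E) : Configuration V r →ₗ[ℝ] ℂ where
  toFun u := r (G.color a) * u.1 (G.head a) + (u.2 : Γ → ℂ) (G.color a) - u.1 (G.tail a)
  map_add' u v := by
    simp only [Prod.fst_add, Prod.snd_add, Pi.add_apply, Submodule.coe_add]
    ring
  map_smul' c u := by
    simp only [Prod.smul_fst, Prod.smul_snd, Pi.smul_apply, Submodule.coe_smul, Complex.real_smul,
      RingHom.id_apply]
    ring

theorem edgeVector_apply (a : E) (u : Configuration V r) : edgeVector r G a u =
    r (G.color a) * u.1 (G.head a) + (u.2 : Γ → ℂ) (G.color a) - u.1 (G.tail a) := rfl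

/-- The configurations in which every edge in `F` has coincident endpoints. -/
noncomputable def collapsed (F : Finset E) : Submodule ℝ (Configuration V r) :=
  ⨅ a ∈ F, LinearMap.ker (edgeVector r G a)

variable {r G}

theorem mem_collapsed {F : Finset E} {u : Configuration V r} :
    u ∈ collapsed r G F ↔ ∀ a ∈ F, edgeVector r G a u = 0 := by
  simp [collapsed, Submodule.mem_iInf]

theorem walk_collapsed {F : Finset E} {u : Configuration V r} (hu : u ∈ collapsed r G F)
    {b v : V} {g : Γ} (p : G.Walk F b v g) : r g * u.1 v + (u.2 : Γ → ℂ) g = u.1 b := by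
  rw [mem_collapsed] at hu
  induction p with
  | nil => simp [cocycle_one u.2.2]
  | @forward e g he _ ih =>
    have h1 := hu e he
    rw [edgeVector_apply] at h1
    rw [u.2.2, map_mul, Circle.coe_mul, ← ih]
    linear_combination (r g : ℂ) * h1
  | @backward e g he _ ih =>
    have h1 := hu e he
    rw [edgeVector_apply] at h1
    have h2 := u.2.2 (g * (G.color e)⁻¹) (G.color e)
    rw [inv_mul_cancel_right] at h2
    have h3 : (r g : ℂ) = r (g * (G.color e)⁻¹) * r (G.color e) := by
      rw [← Circle.coe_mul, ← map_mul, inv_mul_cancel_right]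
    rw [← ih, h2, h3]
    linear_combination (-(r (g * (G.color e)⁻¹) : ℂ)) * h1

/-- A collapsed configuration with a given cocycle is determined by the positions of the base
vertices of the components, which can be chosen freely among the common fixed points of the groups
of the components. -/
theorem exists_collapsed {F : Finset E} (τ : cocycles r) (q : Quotient (G.compSetoid F) → ℂ)
    (hq : ∀ c, ∀ g ∈ G.gainGroup F c.out, r g * q c + (τ : Γ → ℂ) g = q c) :
    ∃ p : V → ℂ, (p, τ) ∈ collapsed r G F ∧ ∀ c : Quotient (G.compSetoid F), p c.out = q c := by
  have hwalk : ∀ v : V, ∃ g, G.Walk F (Quotient.mk (G.compSetoid F) v).out v g := fun v =>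
    Quotient.exact (s := G.compSetoid F) (Quotient.out_eq _)
  choose k hk using hwalk
  let p : V → ℂ := fun v => (r (k v) : ℂ)⁻¹ *
    (q (Quotient.mk (G.compSetoid F) v) - (τ : Γ → ℂ) (k v))
  have key : ∀ (c : Quotient (G.compSetoid F)) (v : V) (g : Γ), G.Walk F c.out v g →
      r g * p v + (τ : Γ → ℂ) g = q c := by
    intro c v g hg
    have hc : c = Quotient.mk (G.compSetoid F) v := by
      rw [← Quotient.out_eq c]
      exact Quotient.sound ⟨g, hg⟩
    subst hc
    have h1 := hq _ (g * (k v)⁻¹) (hg.trans (hk v).symm)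
    have h2 : r (k v) * p v = q (Quotient.mk (G.compSetoid F) v) - (τ : Γ → ℂ) (k v) :=
      mul_inv_cancel_left₀ (Circle.coe_ne_zero _) _
    have h3 := τ.2 (g * (k v)⁻¹) (k v)
    rw [inv_mul_cancel_right] at h3
    have h4 : (r g : ℂ) = r (g * (k v)⁻¹) * r (k v) := by
      rw [← Circle.coe_mul, ← map_mul, inv_mul_cancel_right]
    rw [h3, h4]
    linear_combination (r (g * (k v)⁻¹) : ℂ) * h2 + h1
  refine ⟨p, mem_collapsed.2 fun a ha => ?_, fun c => ?_⟩
  · have h1 := key _ _ _ (hk (G.tail a))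
    have h2 := key _ _ _ ((hk (G.tail a)).forward ha)
    rw [τ.2, map_mul, Circle.coe_mul] at h2
    rw [edgeVector_apply]
    refine mul_left_cancel₀ (Circle.coe_ne_zero (r (k (G.tail a)))) ?_
    linear_combination h2 - h1
  · have := key c c.out 1 ColoredGraph.Walk.nil
    simpa [cocycle_one τ.2] using this

variable (r) in
/-- The vectors of the plane that are fixed by the rotational parts of a subgroup. -/
def fixedVectors (H : Subgroup Γ) : Submodule ℝ ℂ where
  carrier := {q | ∀ g ∈ H, (r g : ℂ) * q = q}
  add_mem' ha hb g hg := by rw [mul_add, ha g hg, hb g hg]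
  zero_mem' g _ := mul_zero _
  smul_mem' c q hq g hg := by rw [mul_smul_comm, hq g hg]

theorem HasRotations.finrank_fixedVectors {Φ₀ : Γ →* Euc} (h : HasRotations r Φ₀)
    (H : Subgroup Γ) : finrank ℝ (fixedVectors r H) = T Φ₀ H := by
  rw [T, h.transl_eq]
  split_ifs with hH
  · have : fixedVectors r H = ⊤ := by
      refine eq_top_iff.2 fun q _ g hg => ?_
      rw [MonoidHom.mem_ker.1 (hH hg), Circle.coe_one, one_mul]
    rw [this, finrank_top, Complex.finrank_real_complex]
  · obtain ⟨g, hg, hgr⟩ := SetLike.not_le_iff_exists.1 hH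
    have : fixedVectors r H = ⊥ := by
      refine eq_bot_iff.2 fun q hq => ?_
      have h1 := hq g hg
      by_contra h0
      exact hgr (Circle.coe_injective ((mul_eq_right₀ h0).1 h1))
    rw [this, finrank_bot]

/-- Vertices outside a subgraph do not meet its edges. -/
theorem walk_eq_of_notMem {W : Finset V} {F : Finset E}
    (hWF : ∀ e ∈ F, G.tail e ∈ W ∧ G.head e ∈ W) {v w : V} {g : Γ} (hv : v ∉ W)
    (p : G.Walk F v w g) : v = w ∧ g = 1 := by
  induction p with
  | nil => exact ⟨rfl, rfl⟩
  | forward he _ ih => exact absurd (ih.1 ▸ (hWF _ he).1) hv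
  | backward he _ ih => exact absurd (ih.1 ▸ (hWF _ he).2) hv

variable [Fintype V]

theorem comps_univ (F : Finset E) [Fintype (Quotient (G.compSetoid F))] :
    G.comps Finset.univ F = Finset.univ := by
  classical
  refine Finset.eq_univ_of_forall fun c => ?_
  rw [ColoredGraph.comps, Finset.mem_image]
  exact ⟨c.out, Finset.mem_univ _, Quotient.out_eq c⟩

theorem mem_vanishing_translGroup {Φ₀ : Γ →* Euc} (h : HasRotations r Φ₀) {F : Finset E}
    {τ : cocycles r} : τ ∈ vanishing r (G.translGroup Φ₀ Finset.univ F) ↔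
      ∀ c : Quotient (G.compSetoid F), ∀ g ∈ G.gainGroup F c.out, r g = 1 →
        (τ : Γ → ℂ) g = 0 := by
  have := Fintype.ofFinite (Quotient (G.compSetoid F))
  rw [mem_vanishing]
  constructor
  · intro h0 c g hg hr
    refine h0 g ?_
    have hle : G.gainGroup F c.out ⊓ transl Φ₀ ≤ G.translGroup Φ₀ Finset.univ F :=
      le_iSup₂_of_le (f := fun c (_ : c ∈ G.comps Finset.univ F) =>
        G.gainGroup F c.out ⊓ transl Φ₀) c (by rw [comps_univ]; exact Finset.mem_univ c) le_rfl
    exact hle ⟨hg, h.mem_transl.2 hr⟩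
  · intro h0
    let N : Subgroup Γ :=
      { carrier := {g | r g = 1 ∧ (τ : Γ → ℂ) g = 0}
        one_mem' := ⟨map_one r, cocycle_one τ.2⟩
        mul_mem' := fun {a b} ha hb => ⟨by rw [map_mul, ha.1, hb.1, one_mul], by
          rw [τ.2, ha.2, hb.2, mul_zero, add_zero]⟩
        inv_mem' := fun {a} ha => ⟨by rw [map_inv, ha.1, inv_one], by
          have := τ.2 a a⁻¹
          rw [mul_inv_cancel, cocycle_one τ.2, ha.2, ha.1, Circle.coe_one, one_mul, zero_add]
            at this
          exact this.symm⟩ }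
    have hle : G.translGroup Φ₀ Finset.univ F ≤ N :=
      iSup₂_le fun c _ g hg => ⟨h.mem_transl.1 hg.2, h0 c g hg.1 (h.mem_transl.1 hg.2)⟩
    exact fun g hg => (hle hg).2

theorem finrank_collapsed {Φ₀ : Γ →* Euc} (h : HasRotations r Φ₀)
    [FiniteDimensional ℝ (cocycles r)] (F : Finset E) :
    finrank ℝ (collapsed r G F) = finrank ℝ (vanishing r (G.translGroup Φ₀ Finset.univ F)) +
      ∑ c ∈ G.comps Finset.univ F, T Φ₀ (G.gainGroup F c.out) := by
  have := Fintype.ofFinite (Quotient (G.compSetoid F))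
  let π : collapsed r G F →ₗ[ℝ] cocycles r :=
    LinearMap.snd ℝ (V → ℂ) (cocycles r) ∘ₗ (collapsed r G F).subtype
  have hrange : LinearMap.range π = vanishing r (G.translGroup Φ₀ Finset.univ F) := by
    ext τ
    rw [mem_vanishing_translGroup h]
    constructor
    · rintro ⟨u, rfl⟩ c
      exact (exists_fixed_iff (u : Configuration V r).2.2 _).1
        ⟨(u : Configuration V r).1 c.out, fun g hg => walk_collapsed u.2 hg⟩
    · intro h0
      choose q hq using fun c : Quotient (G.compSetoid F) =>
        (exists_fixed_iff τ.2 (G.gainGroup F c.out)).2 (h0 c)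
      obtain ⟨p, hp, -⟩ := exists_collapsed τ q hq
      exact ⟨⟨_, hp⟩, rfl⟩
  -- with the zero cocycle, the base vertices move freely among the fixed vectors
  let β : LinearMap.ker π →ₗ[ℝ] (c : Quotient (G.compSetoid F)) →
      fixedVectors r (G.gainGroup F c.out) :=
    LinearMap.pi fun c => LinearMap.codRestrict _
      (LinearMap.proj c.out ∘ₗ LinearMap.fst ℝ (V → ℂ) (cocycles r) ∘ₗ
        (collapsed r G F).subtype ∘ₗ (LinearMap.ker π).subtype) fun u g hg => by
          have h1 := walk_collapsed u.1.2 hg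
          have h2 : (u.1 : Configuration V r).2 = 0 := u.2
          rw [h2] at h1
          simpa using h1
  have hβ : Function.Bijective β := by
    constructor
    · intro u u' huu'
      have h2 : (u.1 : Configuration V r).2 = 0 := u.2
      have h2' : (u'.1 : Configuration V r).2 = 0 := u'.2
      refine Subtype.ext (Subtype.ext (Prod.ext (funext fun v => ?_) (h2.trans h2'.symm)))
      obtain ⟨g, hg⟩ : ∃ g, G.Walk F (Quotient.mk (G.compSetoid F) v).out v g :=
        Quotient.exact (s := G.compSetoid F) (Quotient.out_eq _)
      have h1 := walk_collapsed u.1.2 hg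
      have h1' := walk_collapsed u'.1.2 hg
      have h3 : (u.1 : Configuration V r).1 (Quotient.mk (G.compSetoid F) v).out =
          (u'.1 : Configuration V r).1 (Quotient.mk (G.compSetoid F) v).out :=
        congrArg Subtype.val (congrFun huu' (Quotient.mk (G.compSetoid F) v))
      rw [h2] at h1
      rw [h2', ← h3, ← h1] at h1'
      exact (mul_left_cancel₀ (Circle.coe_ne_zero (r g)) (add_right_cancel h1')).symm
    · intro q
      obtain ⟨p, hp, hpq⟩ := exists_collapsed (0 : cocycles r)
        (fun c => (q c : ℂ)) fun c g hg => by simpa using (q c).2 g hg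
      exact ⟨⟨⟨_, hp⟩, rfl⟩, funext fun c => Subtype.ext (hpq c)⟩
  have hrn := LinearMap.finrank_range_add_finrank_ker (K := ℝ) (V := collapsed r G F)
    (V₂ := cocycles r) π
  rw [hrange, (LinearEquiv.ofBijective β hβ).finrank_eq, finrank_pi_fintype] at hrn
  simp only [h.finrank_fixedVectors] at hrn
  rw [comps_univ, hrn]

theorem finrank_configuration [FiniteDimensional ℝ (cocycles r)] :
    finrank ℝ (Configuration V r) = 2 * Fintype.card V + finrank ℝ (cocycles r) := by
  rw [finrank_prod, finrank_pi_fintype]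
  simp [Complex.finrank_real_complex, mul_comm]

/-- The sparsity function counts the independent conditions that collapse the edges. -/
theorem f_univ_add_finrank_collapsed {Φ₀ : Γ →* Euc} (hΓ : IsCrystallographic Φ₀)
    (h : HasRotations r Φ₀) [FiniteDimensional ℝ (cocycles r)] (F : Finset E) :
    G.f Φ₀ Finset.univ F + finrank ℝ (collapsed r G F) = finrank ℝ (Configuration V r) := by
  have h1 := hΓ.rep_add_finrank_vanishing h (G.translGroup Φ₀ Finset.univ F)
  rw [finrank_collapsed h, finrank_configuration, ColoredGraph.f, Finset.card_univ, ← h1]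
  push_cast
  ring

theorem finrank_ker_coboundary {Φ₀ : Γ →* Euc} (h : HasRotations r Φ₀) :
    finrank ℝ (LinearMap.ker (coboundary r)) = T Φ₀ (⊤ : Subgroup Γ) := by
  rw [← h.finrank_fixedVectors]
  suffices LinearMap.ker (coboundary r) = fixedVectors r ⊤ by rw [this]
  ext q
  rw [LinearMap.mem_ker, Subtype.ext_iff, funext_iff]
  refine ⟨fun h1 g _ => ?_, fun h1 g => ?_⟩
  · have := h1 g
    rw [coboundary_apply] at this
    exact (sub_eq_zero.1 this).symm
  · rw [coboundary_apply, h1 g trivial, sub_self]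
    rfl

theorem lamanCount_eq {Φ₀ : Γ →* Euc} (hΓ : IsCrystallographic Φ₀) (h : HasRotations r Φ₀)
    [FiniteDimensional ℝ (cocycles r)] :
    lamanCount Φ₀ (Fintype.card V) = finrank ℝ (Configuration V r) - 3 := by
  have h1 := hΓ.rep_add_finrank_vanishing h (transl Φ₀)
  have h2 := LinearMap.finrank_range_add_finrank_ker (coboundary r)
  rw [finrank_ker_coboundary h, ← vanishing_ker, ← h.transl_eq,
    Complex.finrank_real_complex] at h2
  rw [lamanCount, finrank_configuration]
  omega

/-- Isolated vertices do not change the sparsity function. -/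
theorem f_eq_f_univ (Φ₀ : Γ →* Euc) {W : Finset V} {F : Finset E}
    (hWF : ∀ e ∈ F, G.tail e ∈ W ∧ G.head e ∈ W) : G.f Φ₀ W F = G.f Φ₀ Finset.univ F := by
  classical
  have hout : ∀ v ∉ W, (Quotient.mk (G.compSetoid F) v).out = v := fun v hv => by
    obtain ⟨g, hg⟩ : ∃ g, G.Walk F v (Quotient.mk (G.compSetoid F) v).out g :=
      Quotient.exact (s := G.compSetoid F) (Quotient.out_eq _).symm
    exact (walk_eq_of_notMem hWF hv hg).1.symm
  have hgain : ∀ v ∉ W, G.gainGroup F (Quotient.mk (G.compSetoid F) v).out = ⊥ := fun v hv => by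
    rw [hout v hv, eq_bot_iff]
    exact fun g hg => Subgroup.mem_bot.2 (walk_eq_of_notMem hWF hv hg).2
  have hunion : G.comps Finset.univ F = G.comps W F ∪ G.comps Wᶜ F := by
    rw [ColoredGraph.comps, ColoredGraph.comps, ColoredGraph.comps, ← Finset.image_union,
      Finset.union_compl]
  have hdisj : Disjoint (G.comps W F) (G.comps Wᶜ F) := by
    rw [Finset.disjoint_left]
    intro c hc hc'
    obtain ⟨w, hw, rfl⟩ := Finset.mem_image.1 hc
    obtain ⟨v, hv, hvw⟩ := Finset.mem_image.1 hc'
    obtain ⟨g, hg⟩ := Quotient.exact (s := G.compSetoid F) hvw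
    exact Finset.mem_compl.1 hv ((walk_eq_of_notMem hWF (Finset.mem_compl.1 hv) hg).1 ▸ hw)
  have hsum : ∑ c ∈ G.comps Wᶜ F, (T Φ₀ (G.gainGroup F c.out) : ℤ) = 2 * (Wᶜ.card : ℤ) := by
    rw [ColoredGraph.comps, Finset.sum_image, mul_comm, ← nsmul_eq_mul]
    · refine Finset.sum_eq_card_nsmul fun v hv => ?_
      rw [hgain v (Finset.mem_compl.1 hv), T, if_pos bot_le]
      rfl
    · intro v hv w _ hvw
      obtain ⟨g, hg⟩ := Quotient.exact (s := G.compSetoid F) hvw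
      exact (walk_eq_of_notMem hWF (Finset.mem_compl.1 hv) hg).1
  have htransl : G.translGroup Φ₀ Finset.univ F = G.translGroup Φ₀ W F := by
    rw [ColoredGraph.translGroup, ColoredGraph.translGroup]
    refine le_antisymm (iSup₂_le fun c hc => ?_) (biSup_mono fun c hc => ?_)
    · rw [hunion, Finset.mem_union] at hc
      rcases hc with hc | hc
      · exact le_iSup₂_of_le (f := fun c (_ : c ∈ G.comps W F) =>
          G.gainGroup F c.out ⊓ transl Φ₀) c hc le_rfl
      · obtain ⟨v, hv, rfl⟩ := Finset.mem_image.1 hc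
        rw [hgain v (Finset.mem_compl.1 hv), bot_inf_eq]
        exact bot_le
    · rw [hunion]
      exact Finset.mem_union_left _ hc
  have hcard : (W.card : ℤ) + Wᶜ.card = Fintype.card V := by
    exact_mod_cast Finset.card_add_card_compl W
  rw [ColoredGraph.f, ColoredGraph.f, htransl, hunion, Finset.sum_union hdisj, hsum,
    Finset.card_univ]
  linarith

theorem isColoredLaman_iff [Fintype E] {Φ₀ : Γ →* Euc} (hΓ : IsCrystallographic Φ₀)
    (h : HasRotations r Φ₀) [FiniteDimensional ℝ (cocycles r)] : G.IsColoredLaman Φ₀ ↔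
      Fintype.card E + 3 = finrank ℝ (Configuration V r) ∧
      ∀ F : Finset E, F.Nonempty →
        F.card + 1 + finrank ℝ (collapsed r G F) ≤ finrank ℝ (Configuration V r) := by
  rw [ColoredGraph.IsColoredLaman, lamanCount_eq hΓ h]
  refine and_congr (by omega) ⟨fun h1 F hF => ?_, fun h1 W F hF hWF => ?_⟩
  · have h2 := h1 Finset.univ F hF fun _ _ => ⟨Finset.mem_univ _, Finset.mem_univ _⟩
    have h3 := f_univ_add_finrank_collapsed (G := G) hΓ h F
    omega
  · have h2 := h1 F hF
    have h3 := f_univ_add_finrank_collapsed (G := G) hΓ h F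
    rw [f_eq_f_univ Φ₀ hWF]
    omega

end Configurations

end Crystal

/-! ### Realizations as configurations -/

namespace Crystal

open Module

theorem inner_unit_mul (a : Circle) (z d : ℂ) :
    inner ℝ (a * z) (Complex.I * (a * d)) = inner ℝ z (Complex.I * d) := by
  have := (rotation a).inner_map_map z (Complex.I * d)
  rw [rotation_apply, rotation_apply] at this
  rw [← this]
  congr 1
  ring

section Realizations

variable {Γ V E V' E' : Type*} [Group Γ] [MulAction Γ V] [MulAction Γ E] {X : SymGraph Γ V E}
  (Q : X.ColoredQuotient V' E') {Φ₀ Φ : Γ →* Euc} {r : Γ →* Circle} {d : E → ℂ} {p : V → ℂ}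

variable (r) in
/-- The functionals on configurations whose combinations, with the coordinates of a direction as
coefficients, express that an edge has that direction. -/
noncomputable def edgeFunctionals (G : ColoredGraph Γ V' E') (a : E') :
    Fin 2 → Dual ℝ (Configuration V' r) :=
  ![Complex.imLm ∘ₗ edgeVector r G a, -(Complex.reLm ∘ₗ edgeVector r G a)]

theorem commonZeros_edgeFunctionals (G : ColoredGraph Γ V' E') (F : Finset E') :
    commonZeros (edgeFunctionals r G) F = collapsed r G F := by
  ext w
  rw [mem_commonZeros, mem_collapsed]
  refine forall₂_congr fun a _ => ?_
  rw [Fin.forall_fin_two, Complex.ext_iff, and_comm]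
  simp [edgeFunctionals]

theorem combination_edgeFunctionals (a : E') (w : Configuration V' r) :
    combination (edgeFunctionals r Q.graph) (coords Q d) a w =
      inner ℝ (edgeVector r Q.graph a w) (Complex.I * d (Q.erep a)) := by
  simp [combination, edgeFunctionals, coords, Complex.inner]
  ring

/-- A solution of the direction equations that corresponds to a faithful realization. -/
structure IsFaithfulSolution (r : Γ →* Circle) (G : ColoredGraph Γ V' E') (c : E' × Fin 2 → ℝ)
    (w : Configuration V' r) : Prop where
  mem : w ∈ solutions (edgeFunctionals r G) c
  edgeVector_ne_zero : ∀ a, edgeVector r G a w ≠ 0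
  nontrivial : ∃ γ, r γ = 1 ∧ (w.2 : Γ → ℂ) γ ≠ 0

/-- The configuration given by the positions of the vertex representatives and by the vectors
`Φ γ 0`. -/
noncomputable def toConfiguration (h : HasRotations r Φ) (p : V → ℂ) : Configuration V' r :=
  (fun i => p (Q.vrep i), ⟨fun γ => Φ γ 0, h.mem_cocycles⟩)

theorem edgeVector_toConfiguration (h : HasRotations r Φ) (hp : ∀ (γ : Γ) (i : V), p (γ • i) =
    Φ γ (p i)) (a : E') : edgeVector r Q.graph a (toConfiguration Q h p) =
      p (Q.graph.color a • Q.vrep (Q.graph.head a)) - p (Q.vrep (Q.graph.tail a)) := by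
  rw [hp, h.apply]
  rfl

theorem exists_sub_eq_edgeVector (h : HasRotations r Φ) (hp : ∀ (γ : Γ) (i : V), p (γ • i) =
    Φ γ (p i)) {e : E} {i j : V} (he : X.ends e = s(i, j)) : ∃ (a : E') (γ : Γ),
      γ • Q.erep a = e ∧ (p j - p i = r γ * edgeVector r Q.graph a (toConfiguration Q h p) ∨
        p j - p i = -(r γ * edgeVector r Q.graph a (toConfiguration Q h p))) := by
  obtain ⟨a, ⟨γ, rfl⟩, -⟩ := Q.erep_unique e
  refine ⟨a, γ, rfl, ?_⟩
  rw [X.ends_smul, Q.ends_erep, Sym2.map_mk, Sym2.eq_iff] at he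
  rw [edgeVector_toConfiguration Q h hp]
  rcases he with ⟨rfl, rfl⟩ | ⟨rfl, rfl⟩
  · left
    rw [hp γ, hp γ]
    linear_combination h.apply γ (p (Q.graph.color a • Q.vrep (Q.graph.head a))) -
      h.apply γ (p (Q.vrep (Q.graph.tail a)))
  · right
    rw [hp γ, hp γ]
    linear_combination h.apply γ (p (Q.vrep (Q.graph.tail a))) -
      h.apply γ (p (Q.graph.color a • Q.vrep (Q.graph.head a)))

theorem isFaithful_iff (h₀ : HasRotations r Φ₀) (hd : IsDirection Φ₀ d) (h : HasRotations r Φ)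
    (hp : ∀ (γ : Γ) (i : V), p (γ • i) = Φ γ (p i)) : IsFaithful Φ₀ X d p Φ ↔
      IsFaithfulSolution r Q.graph (coords Q d) (toConfiguration Q h p) := by
  constructor
  · intro hf
    refine ⟨mem_solutions.2 fun a => ?_, fun a => ?_, ?_⟩
    · rw [combination_edgeFunctionals, edgeVector_toConfiguration Q h hp]
      exact hf.direction _ _ _ (Q.ends_erep a)
    · rw [edgeVector_toConfiguration Q h hp]
      exact sub_ne_zero.2 (hf.noncollapsed _ _ _ (Q.ends_erep a)).symm
    · obtain ⟨γ, hγ, hne⟩ := hf.nontrivial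
      rw [h₀.mem_transl] at hγ
      exact ⟨γ, hγ, fun h0 => hne (h.eq_one_iff.2 ⟨hγ, h0⟩)⟩
  · intro hf
    refine ⟨⟨h₀.sameRotations_iff.2 h, fun e i j he => ?_, hp⟩, fun e i j he => ?_, ?_⟩
    · obtain ⟨a, γ, rfl, hij⟩ := exists_sub_eq_edgeVector Q h hp he
      have h1 := mem_solutions.1 hf.mem a
      rw [combination_edgeFunctionals] at h1
      rw [hd.equivariant, h₀ γ]
      rcases hij with hij | hij <;> rw [hij]
      · rw [inner_unit_mul, h1]
      · rw [inner_neg_left, inner_unit_mul, h1, neg_zero]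
    · obtain ⟨a, γ, -, hij⟩ := exists_sub_eq_edgeVector Q h hp he
      have h1 := mul_ne_zero (Circle.coe_ne_zero (r γ)) (hf.edgeVector_ne_zero a)
      rintro heq
      rw [heq, sub_self] at hij
      rcases hij with hij | hij
      · exact h1 hij.symm
      · exact h1 (neg_eq_zero.1 hij.symm)
    · obtain ⟨γ, hγ, hne⟩ := hf.nontrivial
      exact ⟨γ, h₀.mem_transl.2 hγ, fun h1 => hne (h.eq_one_iff.1 h1).2⟩

/-- Since the action on the vertices is free, every configuration comes from points and a
representation. -/
theorem exists_toConfiguration_eq (w : Configuration V' r) : ∃ (p : V → ℂ) (Φ : Γ →* Euc)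
    (h : HasRotations r Φ), (∀ (γ : Γ) (i : V), p (γ • i) = Φ γ (p i)) ∧
      toConfiguration Q h p = w := by
  choose i hi _ using Q.vrep_unique
  choose g hg using hi
  have huniq : ∀ γ k, i (γ • Q.vrep k) = k ∧ g (γ • Q.vrep k) = γ := fun γ k => by
    have h1 : i (γ • Q.vrep k) = k := (Q.vrep_unique (γ • Q.vrep k)).unique ⟨_, hg _⟩ ⟨γ, rfl⟩
    have h2 := hg (γ • Q.vrep k)
    rw [h1] at h2
    refine ⟨h1, inv_mul_eq_one.1 (X.free_vertex _ (Q.vrep k) ?_)⟩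
    rw [mul_smul]
    exact inv_smul_eq_iff.2 h2.symm
  obtain ⟨p, hpt⟩ : ∃ p : V → ℂ, ∀ γ k, p (γ • Q.vrep k) = r γ * w.1 k + (w.2 : Γ → ℂ) γ :=
    ⟨fun v => r (g v) * w.1 (i v) + (w.2 : Γ → ℂ) (g v), fun γ k => by
      simp only [(huniq γ k).1, (huniq γ k).2]⟩
  refine ⟨p, ofCocycle w.2.2, hasRotations_ofCocycle _, fun γ v => ?_, ?_⟩
  · rw [ofCocycle_apply, ← hg v, ← mul_smul, hpt, hpt, w.2.2, map_mul, Circle.coe_mul]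
    ring
  · refine Prod.ext (funext fun k => ?_) (Subtype.ext (funext fun γ => ?_))
    · have := hpt 1 k
      rw [one_smul, map_one, Circle.coe_one, one_mul, cocycle_one w.2.2, add_zero] at this
      exact this
    · exact (ofCocycle_apply _ _ _).trans (by rw [mul_zero, zero_add])

theorem hasFaithful_iff (h₀ : HasRotations r Φ₀) (hd : IsDirection Φ₀ d) :
    HasFaithful Φ₀ X d ↔
      ∃ w : Configuration V' r, IsFaithfulSolution r Q.graph (coords Q d) w := by
  constructor
  · rintro ⟨p, Φ, hf⟩
    have h := h₀.sameRotations_iff.1 hf.rotations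
    exact ⟨_, (isFaithful_iff Q h₀ hd h hf.equivariant).1 hf⟩
  · rintro ⟨w, hw⟩
    obtain ⟨p, Φ, h, hp, rfl⟩ := exists_toConfiguration_eq Q w
    exact ⟨p, Φ, (isFaithful_iff Q h₀ hd h hp).2 hw⟩

variable (r V') in
/-- The collapsed configurations that arise from the zero configuration by translations of the
plane. -/
noncomputable def translates : ℂ →ₗ[ℝ] Configuration V' r :=
  (LinearMap.pi fun _ => LinearMap.id).prod (coboundary r)

theorem translateScale_iff {p' : V → ℂ} {Φ' : Γ →* Euc} (h : HasRotations r Φ)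
    (hp : ∀ (γ : Γ) (i : V), p (γ • i) = Φ γ (p i)) (h' : HasRotations r Φ')
    (hp' : ∀ (γ : Γ) (i : V), p' (γ • i) = Φ' γ (p' i)) : TranslateScale p Φ p' Φ' ↔
      ∃ (s : ℝ) (c : ℂ), s ≠ 0 ∧
        toConfiguration Q h' p' = s • toConfiguration Q h p + translates V' r c := by
  refine exists₂_congr fun s c => and_congr_right fun _ => ?_
  constructor
  · rintro ⟨h1, h2⟩
    refine Prod.ext (funext fun i => h1 _) (Subtype.ext (funext fun γ => ?_))
    have := h2 γ 0
    rw [h'.apply, mul_zero, zero_add] at this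
    change Φ' γ 0 = s * Φ γ 0 + (c - r γ * c)
    linear_combination this
  · intro h1
    have h2 : ∀ i, p' (Q.vrep i) = s * p (Q.vrep i) + c := fun i =>
      congrFun (congrArg Prod.fst h1) i
    have h3 : ∀ γ, Φ' γ 0 = s * Φ γ 0 + (c - r γ * c) := fun γ =>
      congrFun (congrArg (fun u : Configuration V' r => (u.2 : Γ → ℂ)) h1) γ
    refine ⟨fun v => ?_, fun γ x => ?_⟩
    · obtain ⟨i, ⟨γ, rfl⟩, -⟩ := Q.vrep_unique v
      rw [hp, hp', h.apply, h'.apply, h2, h3]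
      ring
    · rw [h.apply, h'.apply, h3]
      ring

theorem hasUniqueFaithful_iff (h₀ : HasRotations r Φ₀) (hd : IsDirection Φ₀ d) :
    HasUniqueFaithful Φ₀ X d ↔
      ∃ w : Configuration V' r, IsFaithfulSolution r Q.graph (coords Q d) w ∧
        ∀ w', IsFaithfulSolution r Q.graph (coords Q d) w' →
          ∃ (s : ℝ) (c : ℂ), s ≠ 0 ∧ w' = s • w + translates V' r c := by
  constructor
  · rintro ⟨p, Φ, hf, huniq⟩
    have h := h₀.sameRotations_iff.1 hf.rotations
    refine ⟨_, (isFaithful_iff Q h₀ hd h hf.equivariant).1 hf, fun w' hw' => ?_⟩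
    obtain ⟨p', Φ', h', hp', rfl⟩ := exists_toConfiguration_eq Q w'
    exact (translateScale_iff Q h hf.equivariant h' hp').1
      (huniq p' Φ' ((isFaithful_iff Q h₀ hd h' hp').2 hw'))
  · rintro ⟨w, hw, huniq⟩
    obtain ⟨p, Φ, h, hp, rfl⟩ := exists_toConfiguration_eq Q w
    refine ⟨p, Φ, (isFaithful_iff Q h₀ hd h hp).2 hw, fun p' Φ' hf' => ?_⟩
    have h' := h₀.sameRotations_iff.1 hf'.rotations
    exact (translateScale_iff Q h hp h' hf'.equivariant).2
      (huniq _ ((isFaithful_iff Q h₀ hd h' hf'.equivariant).1 hf'))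

end Realizations

end Crystal

/-! ### Generic directions -/

namespace Crystal

open Module

section Generic

theorem exists_mem_forall_notMem {K U ι : Type*} [Field K] [Infinite K] [AddCommGroup U]
    [Module K U] [Finite ι] {S : Submodule K U} {A : ι → Submodule K U} (h : ∀ i, ¬ S ≤ A i) :
    ∃ w ∈ S, ∀ i, w ∉ A i := by
  by_contra! hcon
  obtain ⟨i, hi⟩ := Subspace.exists_eq_top_of_iUnion_eq_univ
    (p := fun i => (A i).comap S.subtype) (Set.eq_univ_of_forall fun w => by
      obtain ⟨i, hi⟩ := hcon w w.2
      exact Set.mem_iUnion.2 ⟨i, hi⟩)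
  exact h i (Submodule.comap_subtype_eq_top.1 hi)

variable {Γ V E : Type*} [Group Γ] {r : Γ →* Circle} {G : ColoredGraph Γ V E}

/-- Without rotations every linear image of a cocompact cocycle is a cocycle; with a rotation the
complex multiples and the coboundaries suffice. -/
theorem four_le_finrank_cocycles [FiniteDimensional ℝ (cocycles r)] {τ₀ : Γ → ℂ}
    (hτ : τ₀ ∈ cocycles r) (hco : ∃ R : ℝ, ∀ x : ℂ, ∃ γ : Γ, dist (τ₀ γ) x ≤ R) :
    4 ≤ finrank ℝ (cocycles r) := by
  by_cases hr : ∀ γ, r γ = 1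
  · let ψ : (ℂ →ₗ[ℝ] ℂ) →ₗ[ℝ] cocycles r :=
      LinearMap.codRestrict _ (LinearMap.pi fun γ => LinearMap.applyₗ (τ₀ γ)) fun A γ δ => by
        simp [hτ γ δ, hr]
    have hψ : Function.Injective ψ := by
      rw [injective_iff_map_eq_zero]
      intro A hA
      have hA' : ∀ γ, A (τ₀ γ) = 0 := fun γ => congrFun (congrArg Subtype.val hA) γ
      obtain ⟨R, hR⟩ := hco
      let A' : ℂ →L[ℝ] ℂ := LinearMap.toContinuousLinearMap A
      ext1 x
      by_contra hx
      have hx' : 0 < ‖A x‖ := norm_pos_iff.2 hx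
      -- a translation close to a large multiple of `x` contradicts the continuity of `A`
      obtain ⟨n, hn⟩ := exists_nat_gt (‖A'‖ * R / ‖A x‖)
      rw [div_lt_iff₀ hx'] at hn
      obtain ⟨γ, hγ⟩ := hR ((n : ℝ) • x)
      have h1 : A ((n : ℝ) • x - τ₀ γ) = (n : ℝ) • A x := by
        rw [map_sub, hA', sub_zero, map_smul]
      have h2 : ‖A ((n : ℝ) • x - τ₀ γ)‖ ≤ ‖A'‖ * R := by
        refine (A'.le_opNorm _).trans (mul_le_mul_of_nonneg_left ?_ (norm_nonneg _))
        rwa [← dist_eq_norm, dist_comm]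
      rw [h1, norm_smul, Real.norm_of_nonneg (Nat.cast_nonneg n)] at h2
      linarith
    have := LinearMap.finrank_le_finrank_of_injective hψ
    rwa [finrank_linearMap, Complex.finrank_real_complex] at this
  · push Not at hr
    obtain ⟨g, hg⟩ := hr
    obtain ⟨l, hl, hne⟩ := exists_translation_ne_zero hτ hco
    let μ : ℂ →ₗ[ℝ] cocycles r :=
      { toFun := fun c => ⟨_, mul_mem_cocycles hτ c⟩
        map_add' := fun a b => Subtype.ext (funext fun γ => add_mul a b _)
        map_smul' := fun s a => Subtype.ext (funext fun γ => smul_mul_assoc s a _) }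
    have hinj : Function.Injective ((coboundary r).coprod μ) := by
      rw [injective_iff_map_eq_zero]
      rintro ⟨q, c⟩ h0
      have h1 : ∀ γ, q - r γ * q + c * τ₀ γ = 0 := fun γ =>
        congrFun (congrArg Subtype.val h0) γ
      have hc : c = 0 := by
        have := h1 l
        rw [hl, Circle.coe_one, one_mul, sub_self, zero_add] at this
        exact (mul_eq_zero.1 this).resolve_right hne
      have hq : q = 0 := by
        have := h1 g
        rw [hc, zero_mul, add_zero] at this
        by_contra hq
        exact hg (Circle.coe_injective ((mul_eq_right₀ hq).1 (sub_eq_zero.1 this).symm))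
      rw [hc, hq]
      rfl
    have := LinearMap.finrank_le_finrank_of_injective hinj
    rwa [finrank_prod, Complex.finrank_real_complex] at this

/-- The translation vector of the group element `γ` in a configuration. -/
noncomputable def cocycleValue (V : Type*) (r : Γ →* Circle) (γ : Γ) : Configuration V r →ₗ[ℝ] ℂ :=
  LinearMap.proj γ ∘ₗ (cocycles r).subtype ∘ₗ LinearMap.snd ℝ (V → ℂ) (cocycles r)

theorem edgeVector_translates (a : E) (c : ℂ) : edgeVector r G a (translates V r c) = 0 := by
  change r (G.color a) * c + (c - r (G.color a) * c) - c = 0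
  ring

theorem cocycleValue_translates {γ : Γ} (hγ : r γ = 1) (c : ℂ) :
    cocycleValue V r γ (translates V r c) = 0 := by
  change c - r γ * c = 0
  rw [hγ, Circle.coe_one, one_mul, sub_self]

theorem translates_injective [Nonempty V] : Function.Injective (translates V r) := fun _ _ h =>
  congrFun (congrArg Prod.fst h) (Classical.arbitrary V)

theorem translates_mem_solutions (c : E × Fin 2 → ℝ) (q : ℂ) :
    translates V r q ∈ solutions (edgeFunctionals r G) c := by
  refine mem_solutions.2 fun a => ?_
  simp [combination, edgeFunctionals, edgeVector_translates]

/-- In a solution space of dimension at least four, a faithful solution is not unique: the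
solutions that are not faithful or are equivalent to it lie in finitely many proper subspaces. -/
theorem exists_isFaithfulSolution_ne [Finite E] {c : E × Fin 2 → ℝ} {w : Configuration V r}
    (hw : IsFaithfulSolution r G c w)
    (hdim : 4 ≤ finrank ℝ (solutions (edgeFunctionals r G) c)) :
    ∃ w', IsFaithfulSolution r G c w' ∧ ∀ (s : ℝ) (q : ℂ), w' ≠ s • w + translates V r q := by
  obtain ⟨γ, hγ, hne⟩ := hw.nontrivial
  have hD : ¬ solutions (edgeFunctionals r G) c ≤
      Submodule.span ℝ {w} ⊔ LinearMap.range (translates V r) := fun hle => by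
    have h1 := Submodule.finrank_mono hle
    have h2 := Submodule.finrank_add_le_finrank_add_finrank (Submodule.span ℝ {w})
      (LinearMap.range (translates V r))
    have h3 := finrank_span_singleton (K := ℝ) (v := w) fun h0 => hne (by rw [h0]; rfl)
    have h4 := LinearMap.finrank_range_le (translates V r)
    rw [Complex.finrank_real_complex] at h4
    omega
  obtain ⟨w', hw', hA⟩ := exists_mem_forall_notMem
    (S := solutions (edgeFunctionals r G) c) (ι := Option (Option E))
    (A := fun x => x.elim (Submodule.span ℝ {w} ⊔ LinearMap.range (translates V r))
      fun y => y.elim (LinearMap.ker (cocycleValue V r γ))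
        fun a => LinearMap.ker (edgeVector r G a)) (by
      rintro (_ | _ | a)
      · exact hD
      · exact fun hle => hne (hle hw.mem)
      · exact fun hle => hw.edgeVector_ne_zero a (hle hw.mem))
  refine ⟨w', ⟨hw', fun a => hA (some (some a)), γ, hγ, hA (some none)⟩, fun s q heq => ?_⟩
  refine hA none ?_
  rw [heq]
  exact Submodule.add_mem_sup (Submodule.smul_mem _ _ (Submodule.mem_span_singleton_self w))
    ⟨q, rfl⟩

variable [Fintype V] [FiniteDimensional ℝ (cocycles r)]

theorem eq_smul_add_translates [Nonempty V] {c : E × Fin 2 → ℝ} {w w' : Configuration V r}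
    (hw : IsFaithfulSolution r G c w) (hw' : IsFaithfulSolution r G c w')
    (hdim : finrank ℝ (solutions (edgeFunctionals r G) c) ≤ 3) :
    ∃ (s : ℝ) (q : ℂ), s ≠ 0 ∧ w' = s • w + translates V r q := by
  obtain ⟨γ, hγ, hne⟩ := hw.nontrivial
  have hnot : w ∉ LinearMap.range (translates V r) := by
    rintro ⟨q, rfl⟩
    exact hne (cocycleValue_translates (V := V) hγ q)
  have hle : Submodule.span ℝ {w} ⊔ LinearMap.range (translates V r) ≤
      solutions (edgeFunctionals r G) c := by
    refine sup_le ((Submodule.span_singleton_le_iff_mem _ _).2 hw.mem) ?_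
    rintro _ ⟨q, rfl⟩
    exact translates_mem_solutions c q
  have hw0 : w ≠ 0 := fun h0 => hnot (h0 ▸ Submodule.zero_mem _)
  have hrank : finrank ℝ (Submodule.span ℝ {w} ⊔ LinearMap.range (translates V r) :
      Submodule ℝ (Configuration V r)) = 3 := by
    have h1 := Submodule.finrank_sup_add_finrank_inf_eq (Submodule.span ℝ {w})
      (LinearMap.range (translates V r))
    have h2 : Submodule.span ℝ {w} ⊓ LinearMap.range (translates V r) = ⊥ :=
      ((Submodule.disjoint_span_singleton' hw0).2 hnot).symm.eq_bot
    rw [h2, finrank_bot, finrank_span_singleton hw0,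
      LinearMap.finrank_range_of_inj translates_injective, Complex.finrank_real_complex] at h1
    exact h1
  have heq := Submodule.eq_of_le_of_finrank_le hle (hrank ▸ hdim)
  have hmem := hw'.mem
  rw [← heq, Submodule.mem_sup] at hmem
  obtain ⟨_, hs, _, ⟨q, rfl⟩, rfl⟩ := hmem
  obtain ⟨s, rfl⟩ := Submodule.mem_span_singleton.1 hs
  refine ⟨s, q, ?_, rfl⟩
  rintro rfl
  obtain ⟨δ, hδ, hne'⟩ := hw'.nontrivial
  refine hne' ?_
  rw [zero_smul, zero_add]
  exact cocycleValue_translates (V := V) hδ q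

/-- In a graph that is not sparse, generic directions force some set of edges to collapse. -/
theorem exists_mvPolynomial_not_isFaithfulSolution (h : ¬ ∀ F : Finset E, F.Nonempty →
    F.card + 1 + finrank ℝ (collapsed r G F) ≤ finrank ℝ (Configuration V r)) :
    ∃ P : MvPolynomial (E × Fin 2) ℝ, P ≠ 0 ∧ ∀ c, MvPolynomial.eval c P ≠ 0 →
      ∀ w : Configuration V r, ¬ IsFaithfulSolution r G c w := by
  push Not at h
  obtain ⟨F, ⟨a, ha⟩, P, hP, hP'⟩ := exists_mvPolynomial_solutions_le
    (u := edgeFunctionals r G) (h.imp fun F hF => by rwa [commonZeros_edgeFunctionals])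
  refine ⟨P, hP, fun c hc w hw => ?_⟩
  have h1 := hP' c hc hw.mem
  rw [commonZeros_edgeFunctionals, mem_collapsed] at h1
  exact hw.edgeVector_ne_zero a (h1 a ha)

variable [Fintype E]

/-- In a sparse graph, generic direction equations are independent, and their solutions are not
contained in any of the hyperplanes that contain the configurations in which a given edge is
collapsed, or the translation `γ` vanishes. -/
theorem exists_mvPolynomial_isFaithfulSolution {τ₀ : Γ → ℂ} (hτ : τ₀ ∈ cocycles r)
    (hne : ∃ γ, r γ = 1 ∧ τ₀ γ ≠ 0) (h : ∀ F : Finset E, F.Nonempty →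
      F.card + 1 + finrank ℝ (collapsed r G F) ≤ finrank ℝ (Configuration V r)) :
    ∃ P : MvPolynomial (E × Fin 2) ℝ, P ≠ 0 ∧ ∀ c, MvPolynomial.eval c P ≠ 0 →
      finrank ℝ (solutions (edgeFunctionals r G) c) + Fintype.card E =
        finrank ℝ (Configuration V r) ∧
      ∃ w : Configuration V r, IsFaithfulSolution r G c w := by
  obtain ⟨γ, hγ, hne⟩ := hne
  have hy : ∀ x : Option E, ∃ y : Dual ℝ (Configuration V r), y ≠ 0 ∧
      ∀ w, y w ≠ 0 → x.elim (cocycleValue V r γ w) (fun a => edgeVector r G a w) ≠ 0 := by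
    rintro (_ | a)
    · refine ⟨Complex.reLm ∘ₗ cocycleValue V r γ, fun h0 => ?_, fun w hw h0 => hw ?_⟩
      · have h1 := LinearMap.congr_fun h0 (0, ⟨_, mul_mem_cocycles hτ (τ₀ γ)⁻¹⟩)
        change ((τ₀ γ)⁻¹ * τ₀ γ).re = 0 at h1
        rw [inv_mul_cancel₀ hne] at h1
        exact one_ne_zero h1
      · change Complex.re (cocycleValue V r γ w) = 0
        rw [show cocycleValue V r γ w = 0 from h0, Complex.zero_re]
    · have hk : ∃ k, edgeFunctionals r G a k ≠ 0 := by
        by_contra! hk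
        have h1 := h {a} (Finset.singleton_nonempty a)
        have h2 : collapsed r G {a} = ⊤ := by
          rw [← commonZeros_edgeFunctionals, eq_top_iff]
          intro w _ b hb k
          rw [Finset.mem_singleton.1 hb, hk k, LinearMap.zero_apply]
        rw [h2, finrank_top] at h1
        omega
      obtain ⟨k, hk⟩ := hk
      refine ⟨_, hk, fun w hw h0 => hw ?_⟩
      have h1 : w ∈ collapsed r G {a} := mem_collapsed.2 fun b hb => by
        rw [Finset.mem_singleton.1 hb]
        exact h0
      rw [← commonZeros_edgeFunctionals] at h1
      exact h1 a (Finset.mem_singleton_self a) k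
  choose y hy0 hy using hy
  choose P hP0 hP using fun x => exists_mvPolynomial_solutions (u := edgeFunctionals r G)
    (fun F hF => by rw [commonZeros_edgeFunctionals]; exact h F hF) (hy0 x)
  refine ⟨∏ x, P x, Finset.prod_ne_zero_iff.2 fun x _ => hP0 x, fun c hc => ?_⟩
  rw [map_prod, Finset.prod_ne_zero_iff] at hc
  have hPc := fun x => hP x c (hc x (Finset.mem_univ x))
  obtain ⟨w, hw, hwy⟩ := exists_mem_forall_notMem
    (S := solutions (edgeFunctionals r G) c) (A := fun x => LinearMap.ker (y x)) fun x hle => by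
      obtain ⟨w, hw, hne⟩ := (hPc x).2
      exact hne (hle hw)
  exact ⟨(hPc none).1, w, hw, fun a => hy (some a) w (hwy (some a)), γ, hγ, hy none w (hwy none)⟩

/-- A sparse graph has at most as many edges as a colored-Laman graph: the translates of the zero
configuration collapse all edges, so that the collapsed space has dimension at least two. -/
theorem card_add_three_le (hZ : 4 ≤ finrank ℝ (cocycles r)) (h : ∀ F : Finset E, F.Nonempty →
      F.card + 1 + finrank ℝ (collapsed r G F) ≤ finrank ℝ (Configuration V r)) :
    Fintype.card E + 3 ≤ finrank ℝ (Configuration V r) := by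
  rcases isEmpty_or_nonempty E with hE | ⟨⟨a⟩⟩
  · rw [Fintype.card_eq_zero, finrank_configuration]
    omega
  · have : Nonempty V := ⟨G.tail a⟩
    have h1 := h Finset.univ ⟨a, Finset.mem_univ a⟩
    have h2 : LinearMap.range (translates V r) ≤ collapsed r G Finset.univ := by
      rintro _ ⟨q, rfl⟩
      exact mem_collapsed.2 fun b _ => edgeVector_translates b q
    have h3 := Submodule.finrank_mono h2
    rw [LinearMap.finrank_range_of_inj translates_injective, Complex.finrank_real_complex] at h3
    rw [Finset.card_univ] at h1
    omega

end Generic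

end Crystal

open Crystal

theorem theorem3 {Γ : Type*} [Group Γ] (Φ₀ : Γ →* Crystal.Euc)
    (hΓ : Crystal.IsCrystallographic Φ₀)
    {V E : Type*} [MulAction Γ V] [MulAction Γ E] (X : Crystal.SymGraph Γ V E)
    {V' E' : Type*} [Fintype V'] [Fintype E'] (Q : X.ColoredQuotient V' E') :
    ∃ P : MvPolynomial (E' × Fin 2) ℝ, P ≠ 0 ∧
      ∀ d : E → ℂ, Crystal.IsDirection Φ₀ d → MvPolynomial.eval (Crystal.coords Q d) P ≠ 0 →
        (Crystal.HasUniqueFaithful Φ₀ X d ↔ Q.graph.IsColoredLaman Φ₀) ∧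
        (Crystal.lamanCount Φ₀ (Fintype.card V') ≤ (Fintype.card E' : ℤ) →
          (Crystal.HasFaithful Φ₀ X d ↔ Q.graph.IsColoredLaman Φ₀)) := by
  obtain ⟨r, hr⟩ := hΓ.exists_hasRotations
  have h₀ := hr.isDiscreteFaithful_iff.1 hΓ.1
  have := h₀.finiteDimensional
  have hZ := four_le_finrank_cocycles h₀.mem hΓ.2.1
  by_cases hsparse : ∀ F : Finset E', F.Nonempty →
      F.card + 1 + Module.finrank ℝ (collapsed r Q.graph F) ≤
        Module.finrank ℝ (Configuration V' r)
  · have hle := card_add_three_le hZ hsparse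
    by_cases hcard : Fintype.card E' + 3 = Module.finrank ℝ (Configuration V' r)
    · have hlaman : Q.graph.IsColoredLaman Φ₀ := (isColoredLaman_iff hΓ hr).2 ⟨hcard, hsparse⟩
      have : Nonempty V' := by
        by_contra hV
        rw [not_nonempty_iff] at hV
        have hE : IsEmpty E' := ⟨fun a => hV.elim (Q.graph.tail a)⟩
        rw [Fintype.card_eq_zero, finrank_configuration, Fintype.card_eq_zero] at hcard
        omega
      obtain ⟨P, hP, hP'⟩ := exists_mvPolynomial_isFaithfulSolution h₀.mem
        (exists_translation_ne_zero h₀.mem hΓ.2.1) hsparse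
      refine ⟨P, hP, fun d hd hPd => ?_⟩
      rw [hasUniqueFaithful_iff Q hr hd, hasFaithful_iff Q hr hd]
      obtain ⟨hdim, w, hw⟩ := hP' _ hPd
      exact ⟨iff_of_true ⟨w, hw, fun w' hw' => eq_smul_add_translates hw hw' (by omega)⟩ hlaman,
        fun _ => iff_of_true ⟨w, hw⟩ hlaman⟩
    · have hlaman : ¬ Q.graph.IsColoredLaman Φ₀ := fun h =>
        hcard ((isColoredLaman_iff hΓ hr).1 h).1
      refine ⟨1, one_ne_zero, fun d hd _ => ⟨iff_of_false ?_ hlaman, fun hcount => ?_⟩⟩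
      · rw [hasUniqueFaithful_iff Q hr hd]
        rintro ⟨w, hw, huniq⟩
        have hdim := finrank_le_finrank_solutions (edgeFunctionals r Q.graph) (coords Q d)
        obtain ⟨w', hw', hne⟩ := exists_isFaithfulSolution_ne hw (by omega)
        obtain ⟨s, q, -, heq⟩ := huniq w' hw'
        exact hne s q heq
      · rw [lamanCount_eq hΓ hr] at hcount
        omega
  · have hlaman : ¬ Q.graph.IsColoredLaman Φ₀ := fun h =>
      hsparse ((isColoredLaman_iff hΓ hr).1 h).2
    obtain ⟨P, hP, hP'⟩ := exists_mvPolynomial_not_isFaithfulSolution hsparse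
    refine ⟨P, hP, fun d hd hPd => ?_⟩
    rw [hasUniqueFaithful_iff Q hr hd, hasFaithful_iff Q hr hd]
    exact ⟨iff_of_false (fun ⟨w, hw, _⟩ => hP' _ hPd w hw) hlaman,
      fun _ => iff_of_false (fun ⟨w, hw⟩ => hP' _ hPd w hw) hlaman⟩
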